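/- Let $n\ge 3$. A continuous Dyck path of height $n$ is a path $D$ from $(0,0)$ to $(n,n)$ consisting of north steps of unit length and east steps of arbitrary positive length (no two of them consecutive) that never goes below the diagonal $y=x$. For $0\le i\le n-1$ let $x_i(D)$ be the $x$-coordinate of the $i$-th north step of $D$ (indexed from $0$), let $a_i(D)=i-x_i(D)$, and put $$\mathrm{area}(D)=\sum_{i=0}^{n-1}a_i(D),\qquad \mathrm{dinv}(D)=\sum_{0\le i<j\le n-1}\max\{1-|a_i(D)-a_j(D)|,\,0\}.$$ The map $D\mapsto (a_1(D),\dots,a_{n-1}(D))$ identifies the set of continuous Dyck paths of height $n$ with the polytope $$A_n=\{(a_1,\dots,a_{n-1})\in\mathbb R^{n-1} : 0\le a_{i+1}\le a_i+1 \text{ for } 0\le i\le n-2\},\qquad a_0:=0.$$ Let $\lambda_n$ be the measure on continuous Dyck paths corresponding to Lebesgue measure on $A_n$, and let the $q,t$-Catalan measure $\mu_n$ be the pushforward of $\lambda_n$ to $\mathbb R^2$ under $D\mapsto(\mathrm{dinv}(D),\mathrm{area}(D))$. Then $\mu_n$ is absolutely continuous with respect to Lebesgue measure on $\mathbb R^2$,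 and it has a nonnegative measurable density $f_n:\mathbb R^2\to\mathbb R$ which is piecewise polynomial of degree $n-3$. That is, $\mathbb R^2$ can be subdivided into finitely many (possibly unbounded) convex polygonal regions with pairwise disjoint interiors such that on the interior of each region $f_n$ is given by a polynomial of total degree at most $n-3$, and on at least one region with nonempty interior this polynomial is nonzero of degree exactly $n-3$. -/

import Mathlib

open MeasureTheory

noncomputable section

namespace QTCatalan

/-- A continuous Dyck path of height `n`: a path from `(0,0)` to `(n,n)` made of unit north steps
and east steps of arbitrary length which never goes below the diagonal `y = x`. It is recorded by
the `x`-coordinates `x 0 ≤ x 1 ≤ ⋯ ≤ x (n-1)` of its north steps; just before its `i`-th north step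
the path is at `(x i, i)`, so it stays weakly above the diagonal iff `x i ≤ i` for all `i`. -/
@[ext]
structure ContDyckPath (n : ℕ) where
  x : Fin n → ℝ
  nonneg : ∀ i, 0 ≤ x i
  mono : ∀ i j, i ≤ j → x i ≤ x j
  le_diag : ∀ i, x i ≤ (i : ℕ)

/-- Measurable structure on paths: the one induced by the coordinates `x i`. -/
instance (n : ℕ) : MeasurableSpace (ContDyckPath n) :=
  MeasurableSpace.comap ContDyckPath.x inferInstance

/-- The area vector `a_i(D) = i - x_i(D)`. -/
def ContDyckPath.areaVector {n : ℕ} (D : ContDyckPath n) (i : Fin n) : ℝ := (i : ℕ) - D.x i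

/-- The area statistic. -/
def ContDyckPath.area {n : ℕ} (D : ContDyckPath n) : ℝ := ∑ i, D.areaVector i

/-- The function `sc(x) = max (1 - |x|) 0`. -/
def sc (x : ℝ) : ℝ := max (1 - |x|) 0

/-- The dinv statistic, the sum of `sc (a_i - a_j)` over `i < j`. -/
def ContDyckPath.dinv {n : ℕ} (D : ContDyckPath n) : ℝ :=
  ∑ i : Fin n, ∑ j ∈ Finset.Ioi i, sc (D.areaVector i - D.areaVector j)

/-- The inclusion `ℝ^(n-1) = {0} × ℝ^(n-1) ⊆ ℝ^n`, prepending a coordinate `a_0 = 0`. -/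
def prependZero {n : ℕ} (a : Fin (n - 1) → ℝ) (i : Fin n) : ℝ :=
  if h : (i : ℕ) = 0 then 0 else a ⟨(i : ℕ) - 1, by omega⟩

/-- The area polytope `A_n`, as a subset of `ℝ^(n-1)`: all `(a_1, …, a_{n-1})` with
`0 ≤ a_{i+1} ≤ a_i + 1` for all `i ≥ 0`, where `a_0 = 0`. -/
def areaPolytope (n : ℕ) : Set (Fin (n - 1) → ℝ) :=
  {a | ∀ (i : ℕ) (h : i + 1 < n), 0 ≤ prependZero a ⟨i + 1, h⟩ ∧
    prependZero a ⟨i + 1, h⟩ ≤ prependZero a ⟨i, by omega⟩ + 1}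

lemma prependZero_nonneg {n : ℕ} {a : Fin (n - 1) → ℝ} (ha : a ∈ areaPolytope n) (i : Fin n) :
    0 ≤ prependZero a i := by
  obtain ⟨i, hi⟩ := i
  cases i with
  | zero => simp [prependZero]
  | succ k => exact (ha k hi).1

lemma prependZero_step {n : ℕ} {a : Fin (n - 1) → ℝ} (ha : a ∈ areaPolytope n) (i : ℕ) (k : ℕ)
    (h : i + k < n) :
    prependZero a ⟨i + k, h⟩ ≤ prependZero a ⟨i, by omega⟩ + k := by
  induction k with
  | zero => simp
  | succ k ih =>
    have h1 := (ha (i + k) (by omega)).2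
    have h2 := ih (by omega)
    have h3 : prependZero a ⟨i + (k + 1), h⟩ = prependZero a ⟨i + k + 1, by omega⟩ := rfl
    rw [h3]
    push_cast
    linarith

lemma ContDyckPath.areaVector_eq_zero {n : ℕ} (D : ContDyckPath n) (i : Fin n)
    (h : (i : ℕ) = 0) : D.areaVector i = 0 := by
  have h1 := D.nonneg i
  have h2 := D.le_diag i
  simp only [ContDyckPath.areaVector, h, Nat.cast_zero] at *
  linarith

lemma ContDyckPath.prependZero_areaVector {n : ℕ} (D : ContDyckPath n) (i : Fin n) :
    prependZero (fun k : Fin (n - 1) => D.areaVector ⟨(k : ℕ) + 1, by omega⟩) i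
      = D.areaVector i := by
  unfold prependZero
  split_ifs with h
  · exact (D.areaVector_eq_zero i h).symm
  · have e : (⟨(i : ℕ) - 1 + 1, by omega⟩ : Fin n) = i := by ext; simp only; omega
    exact congrArg D.areaVector e

/-- The bijection identifying a continuous Dyck path with its area vector
(without the leading zero). -/
def areaEquiv (n : ℕ) : ContDyckPath n ≃ areaPolytope n where
  toFun D := ⟨fun k => D.areaVector ⟨(k : ℕ) + 1, by omega⟩, by
    intro i h
    rw [D.prependZero_areaVector, D.prependZero_areaVector]
    have h1 := D.le_diag ⟨i + 1, h⟩
    have h2 := D.mono ⟨i, by omega⟩ ⟨i + 1, h⟩ (by simp)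
    simp only [ContDyckPath.areaVector] at *
    push_cast at *
    constructor <;> linarith⟩
  invFun a :=
    { x := fun i => (i : ℕ) - prependZero a.1 i
      nonneg := by
        intro i
        have h0 : 0 + (i : ℕ) < n := by omega
        have h := prependZero_step a.2 0 i h0
        have e : (⟨0 + (i : ℕ), h0⟩ : Fin n) = i := by ext; simp
        rw [e] at h
        have z : prependZero a.1 (⟨0, by omega⟩ : Fin n) = 0 := by simp [prependZero]
        rw [z] at h
        linarith
      mono := by
        intro i j hij
        have hij' : (i : ℕ) ≤ j := hij
        have h0 : (i : ℕ) + ((j : ℕ) - i) < n := by omega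
        have h := prependZero_step a.2 i ((j : ℕ) - i) h0
        have e : (⟨(i : ℕ) + ((j : ℕ) - i), h0⟩ : Fin n) = j := by ext; simp only; omega
        rw [e, Nat.cast_sub hij'] at h
        have h' : prependZero a.1 j ≤ prependZero a.1 i + ((j : ℕ) - (i : ℕ)) := h
        linarith
      le_diag := by
        intro i
        have h := prependZero_nonneg a.2 i
        linarith }
  left_inv D := by
    ext i
    simp only [D.prependZero_areaVector]
    simp [ContDyckPath.areaVector]
  right_inv a := by
    ext k
    simp [ContDyckPath.areaVector, prependZero]

/-- The measure `λ_n` on continuous Dyck paths: Lebesgue measure on the area polytope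
`A_n ⊆ ℝ^(n-1)`, transported to paths along the identification of a path with its area vector. -/
def pathMeasure (n : ℕ) : Measure (ContDyckPath n) :=
  ((volume : Measure (Fin (n - 1) → ℝ)).comap
    (Subtype.val : areaPolytope n → Fin (n - 1) → ℝ)).map (areaEquiv n).symm

/-- The `q,t`-Catalan measure `μ_n` on the plane: the pushforward of `λ_n` by `dinv × area`. -/
def qtCatalanMeasure (n : ℕ) : Measure (ℝ × ℝ) :=
  (pathMeasure n).map fun D => (D.dinv, D.area)

/-- A (possibly unbounded or degenerate) convex polygonal region of the plane: an intersection of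
finitely many closed half-planes `α x + β y ≤ γ`. -/
def IsPolygonalRegion (P : Set (ℝ × ℝ)) : Prop :=
  ∃ H : Finset (ℝ × ℝ × ℝ), P = {p | ∀ h ∈ H, h.1 * p.1 + h.2.1 * p.2 ≤ h.2.2}

/-- `f` is piecewise polynomial of degree `d` on the plane: there is a subdivision of the plane into
finitely many convex polygonal regions with disjoint interiors such that on the interior of each
region `f` is given by a polynomial of total degree at most `d`, and the degree `d` is attained, by
a nonzero polynomial, on some region with nonempty interior. -/
def IsPiecewisePolynomialOfDegree (f : ℝ × ℝ → ℝ) (d : ℕ) : Prop :=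
  ∃ (k : ℕ) (P : Fin k → Set (ℝ × ℝ)) (q : Fin k → MvPolynomial (Fin 2) ℝ),
    (∀ i, IsPolygonalRegion (P i)) ∧
    (⋃ i, P i) = Set.univ ∧
    (∀ i j, i ≠ j → Disjoint (interior (P i)) (interior (P j))) ∧
    (∀ i, (q i).totalDegree ≤ d) ∧
    (∀ i, ∀ p ∈ interior (P i), f p = MvPolynomial.eval ![p.1, p.2] (q i)) ∧
    (∃ i, (interior (P i)).Nonempty ∧ q i ≠ 0 ∧ (q i).totalDegree = d)

end QTCatalan

end

/-! Once the slope of `sc` at every difference a_i − a_j is prescribed, the pair (dinv, area) is an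
affine function of the area vector. The possible slope patterns cut the area polytope into finitely
many polytopal pieces. On a piece where the linear part is onto the plane, the density of the image
measure at a point is, up to a constant, the volume of the fibre, a slice of dimension (n−1)−2 =
n−3. Fibre volumes come from integrating out n−3 coordinates of an indicator function, and each
integration between affine bounds keeps a function piecewise polynomial and raises the degree by at
most one (`IsPW.integral_last`, `exists_density_of_surjective`). Adding up the pieces gives the
density (`exists_density`), and the lines met along the way form an arrangement whose cells are the
required regions.

Surjectivity is the combinatorial point (`gradient_not_const`). The gradient of area is the all-ones
vector, so it must be excluded that all partial derivatives of dinv equal the same c. The largest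
coordinate of the area vector forces c ≤ −1, and the smallest one apart from a_0 forces c ≥ 0.

The degree n−3 is attained near the path x = 0 of maximal area. There dinv is the last coordinate of
x (`dinv_eq_last`), so w = (maximal area) − area − dinv is the sum of the other n−2 free
coordinates. When w is small compared with dinv, these range freely over a cone, so by homogeneity
the volume of {sum ≤ w} is a multiple of w^(n−2) and the density is c·w^(n−3) with c > 0
(`coneSumMeasure_restrict`, `exists_density_near_vertex`). -/

namespace QTCatalan

/-! ### Polynomial functions and their iterated antiderivatives -/

/-- `IsPolyFun d f`: the function `f` on a real vector space is a polynomial of degree at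
most `d`. -/
inductive IsPolyFun {E : Type*} [AddCommGroup E] [Module ℝ E] : ℕ → (E → ℝ) → Prop
  | const (d : ℕ) (c : ℝ) : IsPolyFun d (fun _ => c)
  | add {d : ℕ} {f g : E → ℝ} : IsPolyFun d f → IsPolyFun d g → IsPolyFun d (fun x => f x + g x)
  | mulAffine {d : ℕ} {f : E → ℝ} (A : E →ᵃ[ℝ] ℝ) :
      IsPolyFun d f → IsPolyFun (d + 1) (fun x => A x * f x)

section PolyFun

variable {E F : Type*} [AddCommGroup E] [Module ℝ E] [AddCommGroup F] [Module ℝ F]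

lemma IsPolyFun.const_mul {d : ℕ} {f : E → ℝ} (hf : IsPolyFun d f) (c : ℝ) :
    IsPolyFun d (fun x => c * f x) := by
  induction hf with
  | const d a => exact .const d (c * a)
  | add _ _ h1 h2 => simpa only [mul_add] using h1.add h2
  | mulAffine A _ h => simpa only [mul_left_comm] using h.mulAffine A

lemma IsPolyFun.sub {d : ℕ} {f g : E → ℝ} (hf : IsPolyFun d f) (hg : IsPolyFun d g) :
    IsPolyFun d (fun x => f x - g x) := by
  simpa [sub_eq_add_neg] using hf.add (hg.const_mul (-1))

lemma IsPolyFun.comp {d : ℕ} {f : F → ℝ} (hf : IsPolyFun d f) (φ : E →ᵃ[ℝ] F) :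
    IsPolyFun d (fun x => f (φ x)) := by
  induction hf with
  | const d a => exact .const d a
  | add _ _ h1 h2 => exact h1.add h2
  | mulAffine A _ h => exact h.mulAffine (A.comp φ)

lemma affineMap_prod_apply (A : E × ℝ →ᵃ[ℝ] ℝ) (x : E) (t : ℝ) :
    A (x, t) = A (x, 0) + A.linear (0, 1) * t := by
  have h := A.map_vadd (x, 0) ((0 : E), t)
  have h2 : A.linear ((0 : E), t) = t * A.linear (0, 1) := by
    rw [← smul_eq_mul, ← map_smul]; simp
  simp only [vadd_eq_add, Prod.mk_add_mk, zero_add, add_zero, h2] at h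
  rw [h]; ring

lemma isPolyFun_pow_snd (j : ℕ) : IsPolyFun j (fun z : E × ℝ => z.2 ^ j) := by
  induction j with
  | zero => simpa using IsPolyFun.const (E := E × ℝ) 0 1
  | succ j ih =>
    have := ih.mulAffine (LinearMap.snd ℝ E ℝ).toAffineMap
    simpa [pow_succ'] using this

lemma IsPolyFun.mono {d e : ℕ} {f : E → ℝ} (hf : IsPolyFun d f) (h : d ≤ e) : IsPolyFun e f := by
  induction hf generalizing e with
  | const d a => exact .const e a
  | add _ _ h1 h2 => exact (h1 h).add (h2 h)
  | mulAffine A _ ih =>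
    obtain ⟨e, rfl⟩ : ∃ e', e = e' + 1 := ⟨e - 1, by omega⟩
    exact (ih (by omega)).mulAffine A

/-- A polynomial on `E × ℝ` has iterated antiderivatives in the last variable. -/
lemma IsPolyFun.exists_antideriv {d : ℕ} {f : E × ℝ → ℝ} (hf : IsPolyFun d f) :
    ∃ G : ℕ → E × ℝ → ℝ, G 0 = f ∧ (∀ j, IsPolyFun (d + j) (G j)) ∧
      ∀ j x t, HasDerivAt (fun t => G (j + 1) (x, t)) (G j (x, t)) t := by
  induction hf with
  | const d c =>
    refine ⟨fun j z => c / (j.factorial : ℝ) * z.2 ^ j, by simp, fun j => ?_, fun j x t => ?_⟩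
    · exact ((isPolyFun_pow_snd j).mono (by omega)).const_mul _
    · have h := ((hasDerivAt_pow (j + 1) t).const_mul (c / ((j + 1).factorial : ℝ)))
      refine h.congr_deriv ?_
      have : (j.factorial : ℝ) ≠ 0 := by positivity
      rw [Nat.factorial_succ]
      push_cast
      field_simp
  | add _ _ h1 h2 =>
    obtain ⟨G, hG0, hG, hG'⟩ := h1
    obtain ⟨H, hH0, hH, hH'⟩ := h2
    exact ⟨fun j z => G j z + H j z, by simp [hG0, hH0], fun j => (hG j).add (hH j),
      fun j x t => (hG' j x t).add (hH' j x t)⟩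
  | @mulAffine d f A _ h =>
    obtain ⟨G, hG0, hG, hG'⟩ := h
    -- Repeated integration by parts: A has constant derivative β = `A.linear (0, 1)` in t, and
    -- A·G_j − jβ·G_(j+1) differentiates to the same expression at j−1. The correction uses G_(j+1),
    -- which is why antiderivatives of all orders are carried through the induction.
    refine ⟨fun j z => A z * G j z - (j * A.linear (0, 1)) * G (j + 1) z, by simp [hG0],
      fun j => ?_, fun j x t => ?_⟩
    · exact (((hG j).mulAffine A).mono (by omega)).sub (((hG (j + 1)).mono (by omega)).const_mul _)
    · have hA : HasDerivAt (fun t => A (x, t)) (A.linear (0, 1)) t := by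
        have e : (fun t => A (x, t)) = fun t => A (x, 0) + A.linear (0, 1) * t :=
          funext fun t => affineMap_prod_apply A x t
        rw [e]
        simpa using ((hasDerivAt_id t).const_mul (A.linear (0, 1))).const_add (A (x, 0))
      refine ((hA.mul (hG' j x t)).sub ((hG' (j + 1) x t).const_mul _)).congr_deriv ?_
      push_cast
      ring

end PolyFun

/-! ### Piecewise polynomial functions -/

open Classical in
/-- Piecewise polynomial functions of degree at most `d`, generated by polynomials under addition
and restriction to half-spaces. -/
inductive IsPW {E : Type*} [AddCommGroup E] [Module ℝ E] (d : ℕ) : (E → ℝ) → Prop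
  | poly {f : E → ℝ} : IsPolyFun d f → IsPW d f
  | add {f g : E → ℝ} : IsPW d f → IsPW d g → IsPW d (fun x => f x + g x)
  | cut {f : E → ℝ} (A : E →ᵃ[ℝ] ℝ) : IsPW d f → IsPW d (fun x => if A x ≤ 0 then f x else 0)

section PW

variable {E F : Type*} [AddCommGroup E] [Module ℝ E] [AddCommGroup F] [Module ℝ F]

lemma IsPW.const_mul {d : ℕ} {f : E → ℝ} (hf : IsPW d f) (c : ℝ) :
    IsPW d (fun x => c * f x) := by
  induction hf with
  | poly h => exact .poly (h.const_mul c)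
  | add _ _ h1 h2 => simpa only [mul_add] using h1.add h2
  | cut A _ h => simpa only [mul_ite, mul_zero] using h.cut A

lemma IsPW.zero (d : ℕ) : IsPW d (fun _ : E => (0 : ℝ)) := .poly (.const d 0)

lemma IsPW.sub {d : ℕ} {f g : E → ℝ} (hf : IsPW d f) (hg : IsPW d g) :
    IsPW d (fun x => f x - g x) := by
  simpa [sub_eq_add_neg] using hf.add (hg.const_mul (-1))

lemma IsPW.sum {ι : Type*} {d : ℕ} {f : ι → E → ℝ} (s : Finset ι) (hf : ∀ i ∈ s, IsPW d (f i)) :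
    IsPW d (fun x => ∑ i ∈ s, f i x) := by
  classical
  induction s using Finset.induction_on with
  | empty => simpa using IsPW.zero d
  | insert a s ha ih =>
    simp only [Finset.sum_insert ha]
    exact (hf a (by simp)).add (ih fun i hi => hf i (by simp [hi]))

lemma IsPW.comp {d : ℕ} {f : F → ℝ} (hf : IsPW d f) (φ : E →ᵃ[ℝ] F) :
    IsPW d (fun x => f (φ x)) := by
  induction hf with
  | poly h => exact .poly (h.comp φ)
  | add _ _ h1 h2 => exact h1.add h2
  | cut A _ h => exact h.cut (A.comp φ)

/-- Sets cut out by finitely many affine inequalities, in the sense that restricting to them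
preserves piecewise polynomials. -/
def IsPWSet (S : Set E) : Prop :=
  ∀ (d : ℕ) (f : E → ℝ), IsPW d f → IsPW d (S.indicator f)

lemma isPWSet_le (A : E →ᵃ[ℝ] ℝ) : IsPWSet {x | A x ≤ 0} := by
  intro d f hf
  have := hf.cut A
  convert this using 2 with x
  simp [Set.indicator]

lemma IsPWSet.compl {S : Set E} (hS : IsPWSet S) : IsPWSet Sᶜ := by
  intro d f hf
  rw [Set.indicator_compl]
  exact hf.sub (hS d f hf)

lemma IsPWSet.inter {S T : Set E} (hS : IsPWSet S) (hT : IsPWSet T) : IsPWSet (S ∩ T) := by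
  intro d f hf
  rw [← Set.indicator_indicator]
  exact hS d _ (hT d f hf)

lemma isPWSet_univ : IsPWSet (Set.univ : Set E) := by
  intro d f hf
  simpa using hf

lemma IsPWSet.union {S T : Set E} (hS : IsPWSet S) (hT : IsPWSet T) : IsPWSet (S ∪ T) := by
  have := (hS.compl.inter hT.compl).compl
  rwa [← Set.compl_union, compl_compl] at this

lemma IsPWSet.iInter {ι : Type*} [Finite ι] {S : ι → Set E} (hS : ∀ i, IsPWSet (S i)) :
    IsPWSet (⋂ i, S i) := by
  classical
  have := Fintype.ofFinite ι
  have key : ∀ s : Finset ι, IsPWSet (⋂ i ∈ s, S i) := by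
    intro s
    induction s using Finset.induction_on with
    | empty => simpa using isPWSet_univ
    | insert a s _ ih =>
      rw [Finset.set_biInter_insert]
      exact (hS a).inter ih
  simpa using key Finset.univ

lemma IsPWSet.isPW_indicator_preimage {S : Set F} (hS : IsPWSet S) (φ : E →ᵃ[ℝ] F) :
    IsPW 0 ((φ ⁻¹' S).indicator (fun _ => (1 : ℝ))) :=
  (hS 0 _ (.poly (.const 0 1))).comp φ

end PW

/-! ### Integration of piecewise polynomials in one variable -/

section Analysis

variable {E : Type*} [NormedAddCommGroup E] [NormedSpace ℝ E] [FiniteDimensional ℝ E]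

lemma affineMap_continuous {F : Type*} [NormedAddCommGroup F] [NormedSpace ℝ F]
    (A : E →ᵃ[ℝ] F) : Continuous A :=
  AffineMap.continuous_of_finiteDimensional A

lemma IsPolyFun.continuous {d : ℕ} {f : E → ℝ} (hf : IsPolyFun d f) : Continuous f := by
  induction hf with
  | const d a => exact continuous_const
  | add _ _ h1 h2 => exact h1.add h2
  | mulAffine A _ h => exact (affineMap_continuous A).mul h

lemma IsPW.measurable [MeasurableSpace E] [BorelSpace E] {d : ℕ} {f : E → ℝ} (hf : IsPW d f) :
    Measurable f := by
  induction hf with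
  | poly h => exact h.continuous.measurable
  | add _ _ h1 h2 => exact h1.add h2
  | cut A _ h =>
    exact h.ite ((affineMap_continuous A).measurable measurableSet_Iic) measurable_const

lemma IsPWSet.measurableSet [MeasurableSpace E] [BorelSpace E] {S : Set E} (hS : IsPWSet S) :
    MeasurableSet S := by
  have h := (hS 0 _ (.poly (.const 0 1))).measurable
  rwa [measurable_indicator_const_iff] at h

lemma IsPW.intervalIntegrable {d : ℕ} {f : E × ℝ → ℝ} (hf : IsPW d f) (x : E) (a b : ℝ) :
    IntervalIntegrable (fun t => f (x, t)) volume a b := by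
  induction hf with
  | poly h =>
    exact (h.continuous.comp (by fun_prop : Continuous fun t : ℝ => (x, t))).intervalIntegrable a b
  | add _ _ h1 h2 => exact h1.add h2
  | @cut f A _ h =>
    have hm : MeasurableSet {t : ℝ | A (x, t) ≤ 0} :=
      ((affineMap_continuous A).comp
        (by fun_prop : Continuous fun t : ℝ => (x, t))).measurable measurableSet_Iic
    have e : (fun t => if A (x, t) ≤ 0 then f (x, t) else 0) =
        {t : ℝ | A (x, t) ≤ 0}.indicator fun t => f (x, t) := by
      ext t
      simp [Set.indicator]
    rw [e]
    exact ⟨h.1.indicator hm, h.2.indicator hm⟩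

/-- When the integral starts at the breakpoint v, the interval lies entirely on one side of it: the
cut either leaves the integrand alone or kills it. A cut of the integrand thus becomes a cut of the
integral. -/
lemma intervalIntegral_cut_le (g : ℝ → ℝ) (v u : ℝ) :
    (∫ t in v..u, if t ≤ v then g t else 0) = if u ≤ v then ∫ t in v..u, g t else 0 := by
  split_ifs with h
  · refine intervalIntegral.integral_congr (fun t ht => ?_)
    rw [Set.uIcc_of_ge h] at ht
    simp [ht.2]
  · push Not at h
    rw [intervalIntegral.integral_of_le h.le]
    refine (setIntegral_congr_fun measurableSet_Ioc (g := fun _ => (0 : ℝ)) (fun t ht => ?_)).trans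
      (by simp)
    simp [ht.1]

lemma intervalIntegral_cut_ge (g : ℝ → ℝ) (v u : ℝ) :
    (∫ t in v..u, if v ≤ t then g t else 0) = if v ≤ u then ∫ t in v..u, g t else 0 := by
  split_ifs with h
  · refine intervalIntegral.integral_congr (fun t ht => ?_)
    rw [Set.uIcc_of_le h] at ht
    simp [ht.1]
  · push Not at h
    rw [intervalIntegral.integral_of_ge h.le, integral_Ioc_eq_integral_Ioo]
    rw [setIntegral_congr_fun measurableSet_Ioo (g := fun _ => (0 : ℝ))]
    · simp
    · intro t ht
      simp [ht.2]

/-- Integrating a piecewise polynomial over one variable between affine bounds gives a piecewise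
polynomial of one degree more. -/
lemma IsPW.integral_last {d : ℕ} {f : E × ℝ → ℝ} (hf : IsPW d f) (l u : E →ᵃ[ℝ] ℝ) :
    IsPW (d + 1) (fun x => ∫ t in (l x)..(u x), f (x, t)) := by
  induction hf generalizing l u with
  | @poly f h =>
    obtain ⟨G, hG0, hG, hG'⟩ := h.exists_antideriv
    have e : (fun x => ∫ t in (l x)..(u x), f (x, t)) =
        fun x => G 1 (x, u x) - G 1 (x, l x) := by
      ext x
      refine intervalIntegral.integral_eq_sub_of_hasDerivAt (f := fun t => G 1 (x, t))
        (fun t _ => ?_) ((IsPW.poly h).intervalIntegrable x _ _)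
      simpa [hG0] using hG' 0 x t
    rw [e]
    exact .poly (((hG 1).comp ((AffineMap.id ℝ E).prod u)).sub
      ((hG 1).comp ((AffineMap.id ℝ E).prod l)))
  | @add f g hf hg h1 h2 =>
    have e : (fun x => ∫ t in (l x)..(u x), (f (x, t) + g (x, t))) = fun x =>
        (∫ t in (l x)..(u x), f (x, t)) + ∫ t in (l x)..(u x), g (x, t) := by
      ext x
      exact intervalIntegral.integral_add (hf.intervalIntegrable x _ _)
        (hg.intervalIntegrable x _ _)
    rw [e]
    exact (h1 l u).add (h2 l u)
  | @cut f A hf ih =>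
    set A₀ : E →ᵃ[ℝ] ℝ := A.comp ((AffineMap.id ℝ E).prod (AffineMap.const ℝ E 0)) with hA₀
    set β := A.linear (0, 1) with hβ
    have hA : ∀ x t, A (x, t) = A₀ x + β * t := fun x t => affineMap_prod_apply A x t
    by_cases h0 : β = 0
    -- For β = 0 the condition does not involve t and moves outside the integral.
    · have e : (fun x => ∫ t in (l x)..(u x), if A (x, t) ≤ 0 then f (x, t) else 0) =
          fun x => if A₀ x ≤ 0 then ∫ t in (l x)..(u x), f (x, t) else 0 := by
        ext x
        simp only [hA, h0, zero_mul, add_zero]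
        split_ifs <;> simp
      rw [e]
      exact (ih l u).cut A₀
    -- The breakpoint in t is again an affine function of x, so splitting the integral there keeps
    -- all bounds affine and the induction hypothesis applies.
    · set v : E →ᵃ[ℝ] ℝ := (-β⁻¹) • A₀ with hv
      have hAv : ∀ x t, A (x, t) = β * (t - v x) := by
        intro x t
        rw [hA, hv]
        simp only [AffineMap.coe_smul, Pi.smul_apply, smul_eq_mul]
        field_simp
        ring
      have hsplit : ∀ x, (∫ t in (l x)..(u x), if A (x, t) ≤ 0 then f (x, t) else 0) =
          (∫ t in (v x)..(u x), if A (x, t) ≤ 0 then f (x, t) else 0) -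
          ∫ t in (v x)..(l x), if A (x, t) ≤ 0 then f (x, t) else 0 := fun x =>
        (intervalIntegral.integral_interval_sub_left ((hf.cut A).intervalIntegrable x _ _)
          ((hf.cut A).intervalIntegrable x _ _)).symm
      simp only [hsplit]
      rcases lt_or_gt_of_ne h0 with hneg | hpos
      · have key : ∀ w : E →ᵃ[ℝ] ℝ, IsPW (d + 1)
            (fun x => ∫ t in (v x)..(w x), if A (x, t) ≤ 0 then f (x, t) else 0) := by
          intro w
          have e : ∀ x t, A (x, t) ≤ 0 ↔ v x ≤ t := fun x t => by
            rw [hAv, mul_nonpos_iff]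
            constructor
            · rintro (⟨h1, _⟩ | ⟨_, h2⟩) <;> linarith
            · intro h; exact Or.inr ⟨hneg.le, by linarith⟩
          simp only [e, intervalIntegral_cut_ge]
          have := (ih v w).cut (v - w)
          simpa only [AffineMap.coe_sub, Pi.sub_apply, sub_nonpos] using this
        exact (key u).sub (key l)
      · have key : ∀ w : E →ᵃ[ℝ] ℝ, IsPW (d + 1)
            (fun x => ∫ t in (v x)..(w x), if A (x, t) ≤ 0 then f (x, t) else 0) := by
          intro w
          have e : ∀ x t, A (x, t) ≤ 0 ↔ t ≤ v x := fun x t => by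
            rw [hAv, mul_nonpos_iff]
            constructor
            · rintro (⟨_, h1⟩ | ⟨h2, _⟩) <;> linarith
            · intro h; exact Or.inl ⟨hpos.le, by linarith⟩
          simp only [e, intervalIntegral_cut_le]
          have := (ih v w).cut (w - v)
          simpa only [AffineMap.coe_sub, Pi.sub_apply, sub_nonpos] using this
        exact (key u).sub (key l)

end Analysis

/-! ### Densities of linear images of Lebesgue measure on polytopes -/

lemma map_withDensity_comp {α β : Type*} [MeasurableSpace α] [MeasurableSpace β] {μ : Measure α}
    {ν : Measure β} (e : α ≃ᵐ β) (h : μ.map e = ν) (f : β → ENNReal) :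
    (μ.withDensity (f ∘ e)).map e = ν.withDensity f := by
  ext s hs
  rw [Measure.map_apply e.measurable hs, withDensity_apply _ (e.measurable hs),
    withDensity_apply _ hs, ← h, MeasurableEquiv.restrict_map, lintegral_map_equiv]
  rfl

section Marginal

variable {E : Type*} [NormedAddCommGroup E] [NormedSpace ℝ E] [FiniteDimensional ℝ E]
  [MeasurableSpace E] [BorelSpace E]

/-- The marginal of a compactly supported piecewise polynomial density. -/
lemma IsPW.exists_marginal (μ : Measure E) [SFinite μ] {d : ℕ} {f : E × ℝ → ℝ} (hf : IsPW d f)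
    (h0 : ∀ z, 0 ≤ f z) {R : ℝ} (hR : 0 ≤ R) (hs : ∀ z, f z ≠ 0 → ‖z‖ ≤ R) :
    ∃ g : E → ℝ, IsPW (d + 1) g ∧ (∀ x, 0 ≤ g x) ∧ (∀ x, g x ≠ 0 → ‖x‖ ≤ R) ∧
      ((μ.prod volume).withDensity fun z => ENNReal.ofReal (f z)).map Prod.fst =
        μ.withDensity fun x => ENNReal.ofReal (g x) := by
  have hRR : -R ≤ R := by linarith
  have hfm := hf.measurable
  refine ⟨fun x => ∫ t in (-R)..R, f (x, t), ?_, fun x => ?_, fun x hx => ?_, ?_⟩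
  · simpa using hf.integral_last (AffineMap.const ℝ E (-R)) (AffineMap.const ℝ E R)
  · exact intervalIntegral.integral_nonneg hRR fun t _ => h0 _
  · by_contra hlt
    apply hx
    have : ∀ t, f (x, t) = 0 := fun t => by
      by_contra hne
      exact hlt ((norm_fst_le (x, t)).trans (hs _ hne))
    simp [this]
  · ext s hs'
    have hm : Measurable fun z => ENNReal.ofReal (f z) := hfm.ennreal_ofReal
    rw [Measure.map_apply measurable_fst hs', withDensity_apply _ (measurable_fst hs'),
      withDensity_apply _ hs']
    have e1 : (Prod.fst ⁻¹' s : Set (E × ℝ)) = s ×ˢ Set.univ := by ext; simp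
    rw [e1, setLIntegral_prod _ hm.aemeasurable]
    refine lintegral_congr fun x => ?_
    change _ = ENNReal.ofReal (∫ t in (-R)..R, f (x, t))
    rw [setLIntegral_univ, intervalIntegral.integral_of_le hRR, ← integral_Icc_eq_integral_Ioc,
      ofReal_integral_eq_lintegral_ofReal]
    · rw [← lintegral_indicator measurableSet_Icc]
      refine lintegral_congr fun t => ?_
      by_cases ht : t ∈ Set.Icc (-R) R
      · rw [Set.indicator_of_mem ht]
      · rw [Set.indicator_of_notMem ht]
        have : f (x, t) = 0 := by
          by_contra hne
          exact ht (abs_le.mp ((norm_snd_le (x, t)).trans (hs _ hne)))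
        simp [this]
    · exact (intervalIntegrable_iff_integrableOn_Icc_of_le hRR).mp (hf.intervalIntegrable x _ _)
    · exact Filter.Eventually.of_forall fun t => h0 _

end Marginal

/-- Splitting off the first of the additional coordinates. -/
def splitCoordEquiv (E : Type*) [AddCommGroup E] [Module ℝ E] (k : ℕ) :
    ((E × (Fin k → ℝ)) × ℝ) ≃ₗ[ℝ] E × (Fin (k + 1) → ℝ) where
  toFun z := (z.1.1, Fin.cons z.2 z.1.2)
  invFun w := ((w.1, Fin.tail w.2), w.2 0)
  map_add' a b := by
    ext i
    · rfl
    · refine Fin.cases ?_ (fun j => ?_) i <;> simp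
  map_smul' c a := by
    ext i
    · rfl
    · refine Fin.cases ?_ (fun j => ?_) i <;> simp
  left_inv z := by simp
  right_inv w := by simp

lemma measurePreserving_splitCoordEquiv {E : Type*} [AddCommGroup E] [Module ℝ E]
    [MeasurableSpace E] (μ : Measure E) [SigmaFinite μ] (k : ℕ) :
    MeasurePreserving (splitCoordEquiv E k)
      ((μ.prod (volume : Measure (Fin k → ℝ))).prod volume)
      (μ.prod (volume : Measure (Fin (k + 1) → ℝ))) := by
  have h1 := measurePreserving_prodAssoc μ (volume : Measure (Fin k → ℝ)) (volume : Measure ℝ)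
  have h2 : MeasurePreserving (Prod.swap : (Fin k → ℝ) × ℝ → ℝ × (Fin k → ℝ))
      (volume.prod volume) (volume.prod volume) := Measure.measurePreserving_swap
  have h3 := (volume_preserving_piFinSuccAbove (fun _ : Fin (k + 1) => ℝ) 0).symm
  have h4 := (MeasurePreserving.id μ).prod (h3.comp h2)
  have h5 := h4.comp h1
  convert h5 using 1
  ext z i
  · rfl
  · simp [splitCoordEquiv, MeasurableEquiv.piFinSuccAbove, Fin.insertNthEquiv]
    rfl

/-- Both sides carry sup norms, so the support bound R passes unchanged through each integration. -/
lemma norm_splitCoordEquiv {E : Type*} [NormedAddCommGroup E] [NormedSpace ℝ E] (k : ℕ)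
    (z : (E × (Fin k → ℝ)) × ℝ) : ‖z‖ ≤ ‖splitCoordEquiv E k z‖ := by
  have h1 := norm_fst_le (splitCoordEquiv E k z)
  have h2 := norm_snd_le (splitCoordEquiv E k z)
  have h3 : ∀ i, ‖(splitCoordEquiv E k z).2 i‖ ≤ ‖splitCoordEquiv E k z‖ :=
    fun i => (norm_le_pi_norm _ i).trans h2
  refine max_le (max_le h1 ((pi_norm_le_iff_of_nonneg (norm_nonneg _)).2 fun i => ?_)) ?_
  · simpa [splitCoordEquiv] using h3 i.succ
  · simpa [splitCoordEquiv] using h3 0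

/-- Integrating out `k` coordinates. -/
lemma IsPW.exists_marginal_pi {E : Type*} [NormedAddCommGroup E] [NormedSpace ℝ E]
    [FiniteDimensional ℝ E] [MeasurableSpace E] [BorelSpace E] (μ : Measure E) [SigmaFinite μ]
    {k d : ℕ} {f : E × (Fin k → ℝ) → ℝ} (hf : IsPW d f)
    (h0 : ∀ z, 0 ≤ f z) {R : ℝ} (hR : 0 ≤ R) (hs : ∀ z, f z ≠ 0 → ‖z‖ ≤ R) :
    ∃ g : E → ℝ, IsPW (d + k) g ∧ (∀ x, 0 ≤ g x) ∧
      ((μ.prod volume).withDensity fun z => ENNReal.ofReal (f z)).map Prod.fst =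
        μ.withDensity fun x => ENNReal.ofReal (g x) := by
  induction k generalizing d with
  | zero =>
    refine ⟨fun x => f (x, 0), hf.comp ((AffineMap.id ℝ E).prod (AffineMap.const ℝ E 0)),
      fun x => h0 _, ?_⟩
    have hm : Measurable fun z => ENNReal.ofReal (f z) := hf.measurable.ennreal_ofReal
    ext s hs'
    rw [Measure.map_apply measurable_fst hs', withDensity_apply _ (measurable_fst hs'),
      withDensity_apply _ hs']
    have e1 : (Prod.fst ⁻¹' s : Set (E × (Fin 0 → ℝ))) = s ×ˢ Set.univ := by ext; simp
    rw [e1, setLIntegral_prod _ hm.aemeasurable]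
    refine lintegral_congr fun x => ?_
    rw [volume_pi, Measure.pi_of_empty _ (0 : Fin 0 → ℝ), setLIntegral_univ, lintegral_dirac]
  | succ k ih =>
    set e := splitCoordEquiv E k with he
    have hmp := measurePreserving_splitCoordEquiv μ k
    have hfe : IsPW d (fun z => f (e z)) := hf.comp e.toLinearMap.toAffineMap
    obtain ⟨g, hg, hg0, hgs, hgm⟩ := hfe.exists_marginal (μ.prod volume) (fun z => h0 _) hR
      (fun z hz => (norm_splitCoordEquiv k z).trans (hs _ hz))
    obtain ⟨g', hg', hg0', hgm'⟩ := ih hg hg0 hgs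
    refine ⟨g', by convert hg' using 1; omega, hg0', ?_⟩
    rw [← hgm', ← hgm, Measure.map_map measurable_fst measurable_fst]
    let em : ((E × (Fin k → ℝ)) × ℝ) ≃ᵐ E × (Fin (k + 1) → ℝ) :=
      e.toContinuousLinearEquiv.toHomeomorph.toMeasurableEquiv
    have h1 := map_withDensity_comp em (hmp.map_eq) (fun z => ENNReal.ofReal (f z))
    rw [← h1, Measure.map_map measurable_fst em.measurable]
    rfl

/-- A linear section s of φ splits the source as ℝ² × ker φ through x ↦ (φ x, x − s (φ x)), and the
kernel has dimension m − 2. -/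
lemma exists_coordinates {m : ℕ} (φ : (Fin m → ℝ) →ₗ[ℝ] ℝ × ℝ) (hφ : Function.Surjective φ) :
    ∃ e : (Fin m → ℝ) ≃ₗ[ℝ] (ℝ × ℝ) × (Fin (m - 2) → ℝ), ∀ x, (e x).1 = φ x := by
  obtain ⟨s, hs⟩ := φ.exists_rightInverse_of_surjective (LinearMap.range_eq_top.2 hφ)
  have hker : Module.finrank ℝ (LinearMap.ker φ) = m - 2 := by
    have h1 := φ.finrank_range_add_finrank_ker
    rw [LinearMap.range_eq_top.2 hφ, finrank_top] at h1
    simp at h1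
    omega
  let b : LinearMap.ker φ ≃ₗ[ℝ] (Fin (m - 2) → ℝ) :=
    LinearEquiv.ofFinrankEq _ _ (by simp [hker])
  have hs' : ∀ y, φ (s y) = y := fun y => LinearMap.congr_fun hs y
  let p : (Fin m → ℝ) →ₗ[ℝ] LinearMap.ker φ :=
    (LinearMap.id - s.comp φ).codRestrict _ (fun x => by simp [hs'])
  let L : (Fin m → ℝ) →ₗ[ℝ] (ℝ × ℝ) × (Fin (m - 2) → ℝ) :=
    φ.prod (b.toLinearMap.comp p)
  have hinj : Function.Injective L := by
    rw [← LinearMap.ker_eq_bot, LinearMap.ker_eq_bot']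
    intro x hx
    have h1 : φ x = 0 := congrArg Prod.fst hx
    have h2 : b (p x) = 0 := congrArg Prod.snd hx
    have h3 : p x = 0 := by simpa using h2
    have h4 : x - s (φ x) = 0 := congrArg Subtype.val h3
    simpa [h1] using h4
  have hle : 2 ≤ m := by
    have := LinearMap.finrank_le_finrank_of_surjective hφ
    simpa using this
  exact ⟨LinearEquiv.ofInjectiveOfFinrankEq L hinj (by simp; omega), fun x => rfl⟩

/-- The image of Lebesgue measure on a bounded polytope under a surjective affine map to the plane
has a piecewise polynomial density. -/
lemma exists_density_of_surjective {m : ℕ} (φ : (Fin m → ℝ) →ₗ[ℝ] ℝ × ℝ)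
    (hφ : Function.Surjective φ) (b : ℝ × ℝ) {S : Set (Fin m → ℝ)} (hS : IsPWSet S)
    (hSb : Bornology.IsBounded S) :
    ∃ g : ℝ × ℝ → ℝ, IsPW (m - 2) g ∧ (∀ p, 0 ≤ g p) ∧
      (volume.restrict S).map (fun x => φ x + b) =
        volume.withDensity fun p => ENNReal.ofReal (g p) := by
  obtain ⟨e, he⟩ := exists_coordinates φ hφ
  let em : (Fin m → ℝ) ≃ᵐ (ℝ × ℝ) × (Fin (m - 2) → ℝ) :=
    e.toContinuousLinearEquiv.toHomeomorph.toMeasurableEquiv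
  have hem : ∀ x, em x = e x := fun x => rfl
  have : (Measure.map em (volume : Measure (Fin m → ℝ))).IsAddHaarMeasure :=
    e.toContinuousLinearEquiv.isAddHaarMeasure_map _
  have : (volume : Measure (ℝ × ℝ)).IsAddHaarMeasure :=
    Measure.prod.instIsAddHaarMeasure volume volume
  have : (volume : Measure ((ℝ × ℝ) × (Fin (m - 2) → ℝ))).IsAddHaarMeasure :=
    Measure.prod.instIsAddHaarMeasure volume volume
  -- Uniqueness of Haar measure: a linear isomorphism changes Lebesgue measure by a constant factor,
  -- whose value is never needed.
  obtain ⟨c, hc⟩ : ∃ c : NNReal, Measure.map em (volume : Measure (Fin m → ℝ)) =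
      c • (volume : Measure ((ℝ × ℝ) × (Fin (m - 2) → ℝ))) :=
    ⟨_, Measure.isAddLeftInvariant_eq_smul _ _⟩
  set f : (ℝ × ℝ) × (Fin (m - 2) → ℝ) → ℝ :=
    (e.symm ⁻¹' S).indicator (fun _ => 1) with hf
  have hfPW : IsPW 0 f := hS.isPW_indicator_preimage e.symm.toLinearMap.toAffineMap
  have hf0 : ∀ z, 0 ≤ f z := fun z => Set.indicator_nonneg (fun _ _ => zero_le_one) z
  obtain ⟨R, hR⟩ : ∃ R, ∀ z, f z ≠ 0 → ‖z‖ ≤ R := by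
    obtain ⟨R, hR⟩ := (e.toContinuousLinearEquiv.toContinuousLinearMap.lipschitz.isBounded_image
      hSb).exists_norm_le
    refine ⟨R, fun z hz => hR z ?_⟩
    have : z ∈ e.symm ⁻¹' S := by
      by_contra h
      exact hz (Set.indicator_of_notMem h _)
    exact ⟨e.symm z, this, by simp⟩
  obtain ⟨g, hg, hg0, hgm⟩ := (hfPW.const_mul c).exists_marginal_pi (volume : Measure (ℝ × ℝ))
    (fun z => mul_nonneg c.2 (hf0 z)) (le_max_right R 0)
    (fun z hz => (hR z (right_ne_zero_of_mul hz)).trans (le_max_left _ _))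
  rw [zero_add] at hg
  refine ⟨fun p => g (p - b), hg.comp (AffineMap.id ℝ _ - AffineMap.const ℝ _ b),
    fun p => hg0 _, ?_⟩
  have h1 : (volume.restrict S).map φ = volume.withDensity fun p => ENNReal.ofReal (g p) := by
    rw [← hgm]
    have e1 : (φ : (Fin m → ℝ) → ℝ × ℝ) = Prod.fst ∘ em := by
      ext1 x; simp [hem, he]
    rw [e1, ← Measure.map_map measurable_fst em.measurable]
    congr 1
    have e2 : S = em ⁻¹' (e.symm ⁻¹' S) := by
      ext x; simp [hem]
    have hSm : MeasurableSet (e.symm ⁻¹' S) :=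
      e.symm.toContinuousLinearEquiv.continuous.measurable hS.measurableSet
    rw [e2, ← Measure.restrict_map em.measurable hSm, hc]
    ext s hs
    rw [Measure.restrict_apply hs, withDensity_apply _ hs, Measure.smul_apply]
    have e3 : (fun z => ENNReal.ofReal (c * f z)) =
        (e.symm ⁻¹' S).indicator (fun _ => (c : ENNReal)) := by
      ext z
      by_cases hz : z ∈ e.symm ⁻¹' S
      · simp [hf, Set.indicator_of_mem hz]
      · simp only [hf, Set.indicator_of_notMem hz]; simp
    rw [e3, lintegral_indicator hSm, setLIntegral_const, Measure.restrict_apply hSm,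
      Set.inter_comm]
    rfl
  have h2 : (fun x => φ x + b) = (MeasurableEquiv.addRight b) ∘ φ := rfl
  have h3 := map_withDensity_comp (MeasurableEquiv.addRight b)
    (map_add_right_eq_self (volume : Measure (ℝ × ℝ)) b) (fun p => ENNReal.ofReal (g (p - b)))
  rw [h2, ← Measure.map_map (MeasurableEquiv.measurable _)
    (LinearMap.continuous_of_finiteDimensional φ).measurable, h1, ← h3]
  congr 2
  ext p
  simp

/-! ### Polygonal subdivisions of the plane -/

lemma affineMap_plane_apply (A : ℝ × ℝ →ᵃ[ℝ] ℝ) (p : ℝ × ℝ) :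
    A p = A.linear (1, 0) * p.1 + A.linear (0, 1) * p.2 + A 0 := by
  have h := A.map_vadd 0 p
  have h2 : p = p.1 • (1, 0) + p.2 • (0, 1) := by ext <;> simp
  have h3 : A.linear p = p.1 * A.linear (1, 0) + p.2 * A.linear (0, 1) := by
    conv_lhs => rw [h2]
    simp only [map_add, map_smul, smul_eq_mul]
  simp only [vadd_eq_add, add_zero] at h
  rw [h, h3]
  ring

lemma isOpenMap_of_linear_ne_zero {A : ℝ × ℝ →ᵃ[ℝ] ℝ} (hA : A.linear ≠ 0) : IsOpenMap A :=
  AffineMap.isOpenMap_linear_iff.1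
    (A.linear.isOpenMap_of_finiteDimensional (LinearMap.surjective hA))

lemma IsPolyFun.exists_mvPolynomial {d : ℕ} {f : ℝ × ℝ → ℝ} (hf : IsPolyFun d f) :
    ∃ q : MvPolynomial (Fin 2) ℝ, q.totalDegree ≤ d ∧
      ∀ p, f p = MvPolynomial.eval ![p.1, p.2] q := by
  induction hf with
  | const d c => exact ⟨.C c, by simp, by simp⟩
  | add _ _ h1 h2 =>
    obtain ⟨q, hq, hq'⟩ := h1
    obtain ⟨r, hr, hr'⟩ := h2
    exact ⟨q + r, (MvPolynomial.totalDegree_add q r).trans (max_le hq hr),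
      fun p => by simp [hq', hr']⟩
  | @mulAffine d f A _ h =>
    obtain ⟨q, hq, hq'⟩ := h
    let a : MvPolynomial (Fin 2) ℝ := .C (A.linear (1, 0)) * .X 0 + .C (A.linear (0, 1)) * .X 1 +
      .C (A 0)
    have ha : a.totalDegree ≤ 1 := by
      refine (MvPolynomial.totalDegree_add _ _).trans (max_le
        ((MvPolynomial.totalDegree_add _ _).trans (max_le ?_ ?_)) (by simp)) <;>
      exact (MvPolynomial.totalDegree_mul _ _).trans (by simp)
    refine ⟨a * q, (MvPolynomial.totalDegree_mul _ _).trans (by omega), fun p => ?_⟩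
    simp [a, hq', affineMap_plane_apply A p]

/-- A piecewise polynomial on the plane is polynomial on each cell of a line arrangement. -/
lemma IsPW.exists_arrangement {d : ℕ} {f : ℝ × ℝ → ℝ} (hf : IsPW d f) :
    ∃ H : Finset (ℝ × ℝ →ᵃ[ℝ] ℝ), (∀ A ∈ H, A.linear ≠ 0) ∧
      ∀ T : Set (ℝ × ℝ →ᵃ[ℝ] ℝ), ∃ q : MvPolynomial (Fin 2) ℝ, q.totalDegree ≤ d ∧
        ∀ p, (∀ A ∈ H, (A ∈ T → A p < 0) ∧ (A ∉ T → 0 < A p)) →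
          f p = MvPolynomial.eval ![p.1, p.2] q := by
  classical
  induction hf with
  | poly h =>
    obtain ⟨q, hq, hq'⟩ := h.exists_mvPolynomial
    exact ⟨∅, by simp, fun T => ⟨q, hq, fun p _ => hq' p⟩⟩
  | add _ _ h1 h2 =>
    obtain ⟨H, hH, hq⟩ := h1
    obtain ⟨K, hK, hr⟩ := h2
    refine ⟨H ∪ K, fun A hA => (Finset.mem_union.1 hA).elim (hH A) (hK A), fun T => ?_⟩
    obtain ⟨q, hqd, hq⟩ := hq T
    obtain ⟨r, hrd, hr⟩ := hr T
    refine ⟨q + r, (MvPolynomial.totalDegree_add q r).trans (max_le hqd hrd), fun p hp => ?_⟩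
    beta_reduce
    rw [hq p fun A hA => hp A (Finset.mem_union_left _ hA),
      hr p fun A hA => hp A (Finset.mem_union_right _ hA), map_add]
  | @cut f A _ h =>
    obtain ⟨H, hH, hq⟩ := h
    by_cases hA : A.linear = 0
    · refine ⟨H, hH, fun T => ?_⟩
      obtain ⟨q, hqd, hq⟩ := hq T
      -- A cut by a constant form is vacuous or total. It contributes no line, so the arrangement
      -- contains nonconstant forms only.
      have hc : ∀ p, A p = A 0 := fun p => by simp [affineMap_plane_apply A p, hA]
      by_cases h0 : A 0 ≤ 0
      · exact ⟨q, hqd, fun p hp => by simp [hc p, h0, hq p hp]⟩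
      · exact ⟨0, by simp, fun p _ => by simp [hc p, h0]⟩
    · refine ⟨insert A H, ?_, fun T => ?_⟩
      · intro B hB
        rcases Finset.mem_insert.1 hB with rfl | hB
        exacts [hA, hH B hB]
      obtain ⟨q, hqd, hq⟩ := hq T
      by_cases hT : A ∈ T
      · refine ⟨q, hqd, fun p hp => ?_⟩
        beta_reduce
        rw [if_pos ((hp A (by simp)).1 hT).le]
        exact hq p fun B hB => hp B (by simp [hB])
      · refine ⟨0, by simp, fun p hp => ?_⟩
        beta_reduce
        rw [if_neg (not_le.2 ((hp A (by simp)).2 hT))]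
        simp

/-- The closed cell of a line arrangement where the forms in `T` are nonpositive and the others
nonnegative. -/
def cell (H : Finset (ℝ × ℝ →ᵃ[ℝ] ℝ)) (T : Set (ℝ × ℝ →ᵃ[ℝ] ℝ)) : Set (ℝ × ℝ) :=
  {p | ∀ A ∈ H, (A ∈ T → A p ≤ 0) ∧ (A ∉ T → 0 ≤ A p)}

lemma isPolygonalRegion_cell (H : Finset (ℝ × ℝ →ᵃ[ℝ] ℝ)) (T : Set (ℝ × ℝ →ᵃ[ℝ] ℝ)) :
    IsPolygonalRegion (cell H T) := by
  classical
  refine ⟨H.image fun A => if A ∈ T then (A.linear (1, 0), A.linear (0, 1), -A 0) else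
    (-A.linear (1, 0), -A.linear (0, 1), A 0), ?_⟩
  ext p
  simp only [cell, Set.mem_ofPred_eq, Finset.forall_mem_image]
  refine forall₂_congr fun A _ => ?_
  rw [affineMap_plane_apply A p]
  by_cases hT : A ∈ T
  · simp only [hT, if_true, not_true, forall_true_left, IsEmpty.forall_iff, and_true]
    constructor <;> intro h <;> linarith
  · simp only [hT, if_false, not_false_eq_true, forall_true_left, IsEmpty.forall_iff, true_and]
    constructor <;> intro h <;> linarith

/-- Nonconstant affine forms are open maps, so weak inequalities become strict in the interior. The
values of the function on the lines themselves are therefore irrelevant. -/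
lemma interior_cell {H : Finset (ℝ × ℝ →ᵃ[ℝ] ℝ)} (hH : ∀ A ∈ H, A.linear ≠ 0)
    {T : Set (ℝ × ℝ →ᵃ[ℝ] ℝ)} {p : ℝ × ℝ} (hp : p ∈ interior (cell H T)) :
    ∀ A ∈ H, (A ∈ T → A p < 0) ∧ (A ∉ T → 0 < A p) := by
  intro A hA
  have ho := isOpenMap_of_linear_ne_zero (hH A hA)
  have hc := affineMap_continuous A
  constructor <;> intro hT
  · have h1 : cell H T ⊆ A ⁻¹' Set.Iic 0 := fun p hp => (hp A hA).1 hT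
    have h2 := interior_mono h1 hp
    rw [← ho.preimage_interior_eq_interior_preimage hc, interior_Iic] at h2
    exact h2
  · have h1 : cell H T ⊆ A ⁻¹' Set.Ici 0 := fun p hp => (hp A hA).2 hT
    have h2 := interior_mono h1 hp
    rw [← ho.preimage_interior_eq_interior_preimage hc, interior_Ici] at h2
    exact h2

/-- A nonconstant form maps a nonempty open set onto an open set, which cannot be {0}; hence the
lines can be removed one at a time. -/
lemma exists_mem_off_lines (H : Finset (ℝ × ℝ →ᵃ[ℝ] ℝ)) (hH : ∀ A ∈ H, A.linear ≠ 0)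
    {B : Set (ℝ × ℝ)} (hB : IsOpen B) (hne : B.Nonempty) :
    ∃ U ⊆ B, IsOpen U ∧ U.Nonempty ∧ ∀ p ∈ U, ∀ A ∈ H, A p ≠ 0 := by
  classical
  induction H using Finset.induction_on with
  | empty => exact ⟨B, subset_rfl, hB, hne, by simp⟩
  | insert A H _ ih =>
    obtain ⟨U, hUB, hU, hUne, hUH⟩ := ih fun A hA => hH A (by simp [hA])
    have hc := affineMap_continuous A
    refine ⟨U ∩ A ⁻¹' {0}ᶜ, fun p hp => hUB hp.1, hU.inter (isOpen_compl_singleton.preimage hc),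
      ?_, fun p hp C hC => ?_⟩
    · by_contra hemp
      have h1 : A '' U = {0} := by
        refine Set.eq_singleton_iff_nonempty_unique_mem.2 ⟨hUne.image A, ?_⟩
        rintro _ ⟨p, hp, rfl⟩
        by_contra h
        exact hemp ⟨p, hp, h⟩
      exact not_isOpen_singleton (0 : ℝ) (h1 ▸ isOpenMap_of_linear_ne_zero (hH A (by simp)) U hU)
    · rcases Finset.mem_insert.1 hC with rfl | hC
      exacts [hp.2, hUH p hp.1 C hC]

/-- Restricted to a vertical line through U, the right-hand side has degree exactly d in the second
variable. Univariate polynomials that agree at infinitely many points coincide, and restriction to a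
line cannot raise the degree. -/
lemma le_totalDegree_of_eqOn {q : MvPolynomial (Fin 2) ℝ} {U : Set (ℝ × ℝ)} (hU : IsOpen U)
    (hne : U.Nonempty) {c a : ℝ} (hc : c ≠ 0) {d : ℕ}
    (h : ∀ p ∈ U, MvPolynomial.eval ![p.1, p.2] q = c * (a - p.2 - p.1) ^ d) :
    q ≠ 0 ∧ d ≤ q.totalDegree := by
  obtain ⟨⟨s, y⟩, hsy⟩ := hne
  let r : Polynomial ℝ := MvPolynomial.aeval ![Polynomial.C s, Polynomial.X] q
  have hr : ∀ t, r.eval t = MvPolynomial.eval ![s, t] q := by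
    intro t
    have : (Polynomial.evalRingHom t).comp
        (MvPolynomial.aeval ![Polynomial.C s, Polynomial.X] :
          MvPolynomial (Fin 2) ℝ →ₐ[ℝ] Polynomial ℝ).toRingHom = MvPolynomial.eval ![s, t] := by
      refine MvPolynomial.ringHom_ext (fun x => by simp) (fun i => ?_)
      fin_cases i <;> simp
    exact RingHom.congr_fun this q
  let r' : Polynomial ℝ := .C c * (.C (a - s) - .X) ^ d
  have hrr : r = r' := by
    refine Polynomial.eq_of_infinite_eval_eq _ _ ?_
    have hV : IsOpen ((fun t : ℝ => (s, t)) ⁻¹' U) := hU.preimage (by fun_prop)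
    refine (infinite_of_mem_nhds y (hV.mem_nhds hsy)).mono fun t ht => ?_
    simp only [Set.mem_ofPred_eq, hr, h _ ht, r']
    simp
    left; ring
  have hdeg : r'.natDegree = d := by
    have h1 : (Polynomial.C (a - s) - Polynomial.X : Polynomial ℝ) =
        -(Polynomial.X - Polynomial.C (a - s)) := by ring
    rw [Polynomial.natDegree_C_mul hc, Polynomial.natDegree_pow, h1, Polynomial.natDegree_neg,
      Polynomial.natDegree_X_sub_C, mul_one]
  refine ⟨?_, ?_⟩
  · rintro rfl
    have : r' = 0 := by rw [← hrr]; simp [r]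
    have h2 : (Polynomial.C (a - s) - Polynomial.X : Polynomial ℝ) ≠ 0 := by
      rw [← neg_ne_zero, neg_sub]
      exact Polynomial.X_sub_C_ne_zero _
    exact mul_ne_zero (Polynomial.C_ne_zero.2 hc) (pow_ne_zero d h2) this
  · rw [← hdeg, ← hrr]
    have := MvPolynomial.aeval_natDegree_le q (m := q.totalDegree) le_rfl
      ![Polynomial.C s, Polynomial.X] (n := 1) (fun i => by fin_cases i <;> simp)
    simpa using this

/-- A piecewise polynomial of degree at most `d` which agrees on an open set with a polynomial of
degree exactly `d`. -/
lemma IsPW.isPiecewisePolynomialOfDegree {d : ℕ} {f : ℝ × ℝ → ℝ} (hf : IsPW d f)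
    {B : Set (ℝ × ℝ)} (hB : IsOpen B) (hne : B.Nonempty) {c a : ℝ} (hc : c ≠ 0)
    (h : f =ᵐ[volume.restrict B] fun p => c * (a - p.2 - p.1) ^ d) :
    IsPiecewisePolynomialOfDegree f d := by
  classical
  obtain ⟨H, hH, hq⟩ := hf.exists_arrangement
  choose q hqd hq using hq
  -- Cells are indexed by all sign patterns. Those with empty interior do no harm.
  let e := (Fintype.equivFin H.powerset).symm
  refine ⟨Fintype.card H.powerset, fun i => cell H (e i).1, fun i => q (e i).1,
    fun i => isPolygonalRegion_cell _ _, ?_, fun i j hij => ?_, fun i => hqd _,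
    fun i p hp => hq _ p (interior_cell hH hp), ?_⟩
  · rw [Set.eq_univ_iff_forall]
    intro p
    refine Set.mem_iUnion.2 ⟨e.symm ⟨H.filter fun A => A p ≤ 0, by simp⟩, ?_⟩
    intro A hA
    simp only [Equiv.apply_symm_apply, Finset.coe_filter, Set.mem_ofPred_eq, hA, true_and]
    exact ⟨id, fun h => (not_le.1 h).le⟩
  · rw [Set.disjoint_left]
    intro p hpi hpj
    apply hij
    apply e.injective
    apply Subtype.ext
    ext A
    have hi := interior_cell hH hpi A
    have hj := interior_cell hH hpj A
    have hsi := Finset.mem_powerset.1 (e i).2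
    have hsj := Finset.mem_powerset.1 (e j).2
    constructor <;> intro hA
    · by_contra hA'
      exact lt_asymm ((hi (hsi hA)).1 hA) ((hj (hsi hA)).2 hA')
    · by_contra hA'
      exact lt_asymm ((hj (hsj hA)).1 hA) ((hi (hsj hA)).2 hA')
  · obtain ⟨U, hUB, hU, ⟨p, hp⟩, hUH⟩ := exists_mem_off_lines H hH hB hne
    -- T is the sign pattern of a point p of B off all lines, and V is an open neighbourhood of p
    -- inside both B and the cell of T.
    let T : Finset (ℝ × ℝ →ᵃ[ℝ] ℝ) := H.filter fun A => A p ≤ 0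
    let V : Set (ℝ × ℝ) := U ∩ ⋂ A ∈ H, {x | (A ∈ (T : Set _) → A x < 0) ∧
      (A ∉ (T : Set _) → 0 < A x)}
    have hV : IsOpen V := by
      refine hU.inter (isOpen_biInter_finset fun A hA => ?_)
      have hAc := affineMap_continuous A
      by_cases hT : A ∈ (T : Set _)
      · simp only [hT, not_true, forall_true_left, IsEmpty.forall_iff, and_true]
        exact isOpen_Iio.preimage hAc
      · simp only [hT, not_false_eq_true, forall_true_left, IsEmpty.forall_iff, true_and]
        exact isOpen_Ioi.preimage hAc
    have hpV : p ∈ V := by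
      refine ⟨hp, Set.mem_iInter₂.2 fun A hA => ?_⟩
      have h0 := hUH p hp A hA
      simp only [T, Finset.coe_filter, Set.mem_ofPred_eq, hA, true_and, not_le]
      exact ⟨fun h => lt_of_le_of_ne h h0, id⟩
    have hVcell : V ⊆ cell H T := fun x hx A hA => by
      have := Set.mem_iInter₂.1 hx.2 A hA
      exact ⟨fun h => (this.1 h).le, fun h => (this.2 h).le⟩
    have hVf : ∀ x ∈ V, f x = MvPolynomial.eval ![x.1, x.2] (q T) := fun x hx =>
      hq _ x fun A hA => Set.mem_iInter₂.1 hx.2 A hA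
    have hcont : Continuous fun x : ℝ × ℝ => MvPolynomial.eval ![x.1, x.2] (q T) := by
      refine (MvPolynomial.continuous_eval (q T)).comp (continuous_pi fun i => ?_)
      fin_cases i
      exacts [continuous_fst, continuous_snd]
    have hae : (fun x : ℝ × ℝ => MvPolynomial.eval ![x.1, x.2] (q T))
        =ᵐ[volume.restrict V] fun p => c * (a - p.2 - p.1) ^ d := by
      have h1 := ae_restrict_of_ae_restrict_of_subset (fun x hx => hUB hx.1 : V ⊆ B) h
      filter_upwards [h1, ae_restrict_mem hV.measurableSet] with x hx hxV
      rw [← hVf x hxV, hx]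
    -- Continuous functions equal almost everywhere on an open set are equal on it.
    have heq := Measure.eqOn_open_of_ae_eq hae hV hcont.continuousOn
      (by fun_prop)
    obtain ⟨hq0, hd⟩ := le_totalDegree_of_eqOn hV ⟨p, hpV⟩ hc heq
    refine ⟨e.symm ⟨T, by simp [T]⟩, ?_, ?_, ?_⟩
    · simp only [Equiv.apply_symm_apply]
      exact ⟨p, interior_maximal hVcell hV hpV⟩
    · simpa only [Equiv.apply_symm_apply] using hq0
    · simpa only [Equiv.apply_symm_apply] using le_antisymm (hqd _) hd

/-! ### The linearity regions of the dinv statistic -/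

/-- The dinv statistic as a function of the area vector. -/
noncomputable def dinvFun {n : ℕ} (a : Fin (n - 1) → ℝ) : ℝ :=
  ∑ i : Fin n, ∑ j ∈ Finset.Ioi i, sc (prependZero a i - prependZero a j)

/-- The coordinate `a_i` as a linear form in `(a_1, …, a_{n-1})`. -/
def coordForm {n : ℕ} (i : Fin n) : (Fin (n - 1) → ℝ) →ₗ[ℝ] ℝ :=
  if h : (i : ℕ) = 0 then 0 else LinearMap.proj ⟨(i : ℕ) - 1, by omega⟩

@[simp]
lemma coordForm_apply {n : ℕ} (i : Fin n) (a : Fin (n - 1) → ℝ) :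
    coordForm i a = prependZero a i := by
  unfold coordForm prependZero
  split_ifs <;> simp

lemma measurable_prependZero {n : ℕ} (i : Fin n) :
    Measurable fun a : Fin (n - 1) → ℝ => prependZero a i := by
  simp only [← coordForm_apply]
  exact (LinearMap.continuous_of_finiteDimensional _).measurable

lemma measurable_dinvFun (n : ℕ) : Measurable (dinvFun (n := n)) := by
  refine Finset.measurable_sum _ fun i _ => Finset.measurable_sum _ fun j _ => ?_
  have : Continuous sc := by unfold sc; fun_prop
  exact this.measurable.comp ((measurable_prependZero i).sub (measurable_prependZero j))

lemma areaVector_areaEquiv_symm {n : ℕ} (a : areaPolytope n) (i : Fin n) :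
    ((areaEquiv n).symm a).areaVector i = prependZero a.1 i := by
  simp [ContDyckPath.areaVector, areaEquiv]

/-- The slope of the function `sc`. -/
noncomputable def slope (z : ℝ) : SignType :=
  if z ≤ -1 then 0 else if z ≤ 0 then 1 else if z ≤ 1 then -1 else 0

/-- The constant term is 1 on the two sloped pieces and 0 on the flat ones, which is the square of
the slope. -/
lemma sc_eq_slope (z : ℝ) : sc z = (slope z : ℝ) ^ 2 + (slope z : ℝ) * z := by
  unfold sc slope
  split_ifs with h1 h2 h3
  · rw [abs_of_neg (by linarith), max_eq_right (by linarith)]; simp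
  · rw [abs_of_nonpos h2, max_eq_left (by linarith)]; simp
  · rw [abs_of_pos (by linarith), max_eq_left (by linarith)]; simp; ring
  · rw [abs_of_pos (by linarith), max_eq_right (by linarith)]; simp

/-- At the excluded breakpoints the half-open convention in `slope` destroys the antisymmetry. -/
lemma slope_neg {z : ℝ} (h0 : z ≠ 0) (h1 : z ≠ 1) (h2 : z ≠ -1) : slope (-z) = -slope z := by
  have h0' := lt_or_gt_of_ne h0
  have h1' := lt_or_gt_of_ne h1
  have h2' := lt_or_gt_of_ne h2
  unfold slope
  split_ifs <;> first | rfl | (exfalso; grind)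

lemma isPWSet_slope {E : Type*} [AddCommGroup E] [Module ℝ E] (A : E →ᵃ[ℝ] ℝ) (s : SignType) :
    IsPWSet {x | slope (A x) = s} := by
  have key : ∀ c : ℝ, IsPWSet {x | A x ≤ c} := fun c => by
    have := isPWSet_le (A - AffineMap.const ℝ E c)
    simpa using this
  have e0 : {x | slope (A x) = 0} = {x | A x ≤ -1} ∪ {x | A x ≤ 1}ᶜ := by
    ext x
    simp only [slope, Set.mem_ofPred_eq, Set.mem_union, Set.mem_compl_iff]
    split_ifs with h1 h2 h3 <;> simp [-not_le, *]
    linarith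
  have e1 : {x | slope (A x) = 1} = {x | A x ≤ -1}ᶜ ∩ {x | A x ≤ 0} := by
    ext x
    simp only [slope, Set.mem_ofPred_eq, Set.mem_inter_iff, Set.mem_compl_iff]
    split_ifs with h1 h2 h3 <;> simp [-not_le, *]
  have e2 : {x | slope (A x) = -1} = {x | A x ≤ 0}ᶜ ∩ {x | A x ≤ 1} := by
    ext x
    simp only [slope, Set.mem_ofPred_eq, Set.mem_inter_iff, Set.mem_compl_iff]
    split_ifs with h1 h2 h3 <;> simp [-not_le, *]
    intros
    linarith
  match s with
  | .zero => exact e0 ▸ (key _).union (key _).compl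
  | .pos => exact e1 ▸ (key _).compl.inter (key _)
  | .neg => exact e2 ▸ (key _).compl.inter (key _)

lemma isPWSet_areaPolytope (n : ℕ) : IsPWSet (areaPolytope n) := by
  have e : areaPolytope n = ⋂ k : Fin (n - 1),
      {a | (-coordForm (n := n) ⟨k + 1, by omega⟩).toAffineMap a ≤ 0} ∩
      {a | ((coordForm (n := n) ⟨k + 1, by omega⟩ - coordForm (n := n) ⟨k, by omega⟩).toAffineMap
        - AffineMap.const ℝ (Fin (n - 1) → ℝ) (1 : ℝ)) a ≤ 0} := by
    ext a
    simp only [areaPolytope, Set.mem_ofPred_eq, Set.mem_iInter, Set.mem_inter_iff]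
    constructor
    · intro h k
      have := h k (by omega)
      constructor
      · simpa using this.1
      · have := this.2
        simp at this ⊢
        linarith
    · intro h i hi
      have := h ⟨i, by omega⟩
      constructor
      · simpa using this.1
      · have := this.2
        simp at this ⊢
        linarith
  rw [e]
  exact IsPWSet.iInter fun k => (isPWSet_le _).inter (isPWSet_le _)

lemma prependZero_le {n : ℕ} {a : Fin (n - 1) → ℝ} (ha : a ∈ areaPolytope n) (i : Fin n) :
    prependZero a i ≤ i := by
  have h := ((areaEquiv n).symm ⟨a, ha⟩).nonneg i
  have h2 := areaVector_areaEquiv_symm ⟨a, ha⟩ i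
  simp only [ContDyckPath.areaVector] at h2
  linarith

lemma apply_eq_prependZero {n : ℕ} (a : Fin (n - 1) → ℝ) (k : Fin (n - 1)) :
    a k = prependZero a ⟨k + 1, by omega⟩ := by
  simp [prependZero]

lemma isBounded_areaPolytope (n : ℕ) : Bornology.IsBounded (areaPolytope n) := by
  refine isBounded_iff_forall_norm_le.2 ⟨n, fun a ha => ?_⟩
  refine (pi_norm_le_iff_of_nonneg (Nat.cast_nonneg n)).2 fun k => ?_
  rw [apply_eq_prependZero a k, Real.norm_of_nonneg (prependZero_nonneg ha _)]
  refine (prependZero_le ha _).trans ?_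
  exact_mod_cast (show (k : ℕ) + 1 ≤ n by omega)

lemma qtCatalanMeasure_eq (n : ℕ) : qtCatalanMeasure n =
    (volume.restrict (areaPolytope n)).map fun a => (dinvFun a, ∑ i, prependZero a i) := by
  have hA := (isPWSet_areaPolytope n).measurableSet
  have hsymm : Measurable (areaEquiv n).symm := by
    refine measurable_comap_iff.2 (measurable_pi_lambda _ fun i => ?_)
    exact measurable_const.sub ((measurable_prependZero i).comp measurable_subtype_coe)
  have hx : ∀ i : Fin n, Measurable fun D : ContDyckPath n => D.areaVector i := fun i =>
    measurable_const.sub ((measurable_pi_apply i).comp (comap_measurable ContDyckPath.x))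
  have hsc : Continuous sc := by unfold sc; fun_prop
  have hstat : Measurable fun D : ContDyckPath n => (D.dinv, D.area) := by
    refine Measurable.prodMk ?_ (Finset.measurable_sum _ fun i _ => hx i)
    exact Finset.measurable_sum _ fun i _ => Finset.measurable_sum _ fun j _ =>
      hsc.measurable.comp ((hx i).sub (hx j))
  have hF : Measurable fun a : Fin (n - 1) → ℝ => (dinvFun a, ∑ i, prependZero a i) :=
    (measurable_dinvFun n).prodMk (Finset.measurable_sum _ fun i _ => measurable_prependZero i)
  rw [qtCatalanMeasure, pathMeasure, Measure.map_map hstat hsymm, ← map_comap_subtype_coe hA,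
    Measure.map_map hF measurable_subtype_coe]
  congr 1
  ext a
  · simp [ContDyckPath.dinv, dinvFun, areaVector_areaEquiv_symm]
  · simp [ContDyckPath.area, areaVector_areaEquiv_symm]

/-! ### Nondegeneracy of `(dinv, area)` on the linearity regions -/

/-- The linear part of `dinv` on the region with slopes `σ`. -/
noncomputable def dinvForm {n : ℕ} (σ : Fin n → Fin n → SignType) : (Fin (n - 1) → ℝ) →ₗ[ℝ] ℝ :=
  ∑ i, ∑ j ∈ Finset.Ioi i, (σ i j : ℝ) • (coordForm i - coordForm j)

/-- By antisymmetry each pair contributes alike to the coefficients of both of its members. Applied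
to the slopes, this gives the partial derivative of dinv along a_k as the sum of the slopes at a_k −
a_j over j ≠ k. -/
lemma sum_Ioi_antisymm {n : ℕ} (τ : Fin n → Fin n → ℝ) (hτ : ∀ i j, i ≠ j → τ i j = -τ j i)
    (x : Fin n → ℝ) : ∑ i, ∑ j ∈ Finset.Ioi i, τ i j * (x i - x j) =
      ∑ i, (∑ j ∈ Finset.univ.erase i, τ i j) * x i := by
  have h1 : ∀ i : Fin n, Finset.univ.erase i = Finset.Ioi i ∪ Finset.Iio i := by
    intro i; ext j; simp [lt_or_lt_iff_ne, eq_comm]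
  have h2 : ∀ i : Fin n, Disjoint (Finset.Ioi i) (Finset.Iio i) := by
    intro i
    rw [Finset.disjoint_left]
    intro j hj hj'
    exact lt_asymm (Finset.mem_Ioi.1 hj) (Finset.mem_Iio.1 hj')
  simp only [h1, Finset.sum_union (h2 _), add_mul, Finset.sum_add_distrib, mul_sub,
    Finset.sum_sub_distrib, Finset.sum_mul]
  rw [sub_eq_add_neg, add_right_inj, ← Finset.sum_neg_distrib]
  simp only [← Finset.sum_neg_distrib]
  rw [Finset.sum_comm' (t' := Finset.univ) (s' := fun j => Finset.Iio j) (by simp)]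
  refine Finset.sum_congr rfl fun i _ => Finset.sum_congr rfl fun j hj => ?_
  rw [hτ j i (Finset.mem_Iio.1 hj).ne]
  ring

lemma prependZero_single {n : ℕ} (k : Fin n) (hk : (k : ℕ) ≠ 0) (i : Fin n) :
    prependZero (Pi.single (⟨(k : ℕ) - 1, by omega⟩ : Fin (n - 1)) (1 : ℝ)) i =
      if i = k then 1 else 0 := by
  unfold prependZero
  split_ifs with h1 h2 h2
  · omega
  · rfl
  · subst h2; simp
  · rw [Pi.single_eq_of_ne]
    intro h
    apply h2
    ext
    have := congrArg Fin.val h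
    simp at this
    omega

/-- The points off the walls between the linearity regions. -/
def IsGeneric {n : ℕ} (a : Fin (n - 1) → ℝ) : Prop :=
  ∀ i j : Fin n, i ≠ j → prependZero a i - prependZero a j ≠ 0 ∧
    prependZero a i - prependZero a j ≠ 1 ∧ prependZero a i - prependZero a j ≠ -1

lemma volume_setOf_linear_eq {m : ℕ} (φ : (Fin m → ℝ) →ₗ[ℝ] ℝ) (hφ : φ ≠ 0) (c : ℝ) :
    volume {a | φ a = c} = 0 := by
  obtain ⟨a₀, ha₀⟩ := LinearMap.surjective hφ c
  have e : {a | φ a = c} = (fun a => -a₀ + a) ⁻¹' (LinearMap.ker φ : Set (Fin m → ℝ)) := by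
    ext a
    simp [ha₀, neg_add_eq_zero, eq_comm (a := c)]
  rw [e, measure_preimage_add]
  refine Measure.addHaar_submodule _ _ fun h => hφ ?_
  exact LinearMap.ker_eq_top.1 h

lemma ae_isGeneric (n : ℕ) : ∀ᵐ a : Fin (n - 1) → ℝ, IsGeneric (n := n) a := by
  refine ae_all_iff.2 fun i => ae_all_iff.2 fun j => ?_
  by_cases hij : i = j
  · simp [hij]
  have hne : coordForm i - coordForm j ≠ 0 := by
    intro h
    have key : ∀ a, prependZero a i - prependZero a j = 0 := fun a => by
      simpa using LinearMap.congr_fun h a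
    by_cases hi : (i : ℕ) = 0
    · have hj : (j : ℕ) ≠ 0 := fun hj => hij (Fin.ext (hi.trans hj.symm))
      have := key (Pi.single ⟨(j : ℕ) - 1, by omega⟩ 1)
      rw [prependZero_single j hj, prependZero_single j hj] at this
      simp [hij] at this
    · have := key (Pi.single ⟨(i : ℕ) - 1, by omega⟩ 1)
      rw [prependZero_single i hi, prependZero_single i hi] at this
      simp [Ne.symm hij] at this
  have h : ∀ c : ℝ, ∀ᵐ a : Fin (n - 1) → ℝ, prependZero a i - prependZero a j ≠ c := fun c => by
    have := volume_setOf_linear_eq _ hne c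
    rw [ae_iff]
    simpa using this
  filter_upwards [h 0, h 1, h (-1)] with a h0 h1 h2 _
  exact ⟨h0, h1, h2⟩

lemma slope_of_pos {z : ℝ} (h : 0 < z) : (slope z : ℝ) ≤ 0 := by
  unfold slope
  split_ifs <;> simp
  linarith

lemma slope_of_neg {z : ℝ} (h : z < 0) : 0 ≤ (slope z : ℝ) := by
  unfold slope
  split_ifs <;> simp
  linarith

lemma slope_eq_neg_one {z : ℝ} (h : 0 < z) (h1 : z ≤ 1) : slope z = -1 := by
  unfold slope
  split_ifs <;> first | rfl | (exfalso; linarith)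

lemma slope_eq_one {z : ℝ} (h : -1 < z) (h1 : z < 0) : slope z = 1 := by
  unfold slope
  split_ifs <;> first | rfl | (exfalso; linarith)

lemma neg_one_le_slope (z : ℝ) : (-1 : ℝ) ≤ slope z := by
  unfold slope
  split_ifs <;> simp

/-- The gradient of `dinv` at a generic point of the area polytope is not a multiple of the
gradient of `area`. -/
lemma gradient_not_const {n : ℕ} (hn : 3 ≤ n) {a : Fin (n - 1) → ℝ} (ha : a ∈ areaPolytope n)
    (hg : IsGeneric (n := n) a) (c : ℝ) :
    ∃ k : Fin n, (k : ℕ) ≠ 0 ∧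
      ∑ j ∈ Finset.univ.erase k, (slope (prependZero a k - prependZero a j) : ℝ) ≠ c := by
  set b := prependZero (n := n) a with hb
  by_contra! hc
  have hinj : ∀ i j, i ≠ j → b i ≠ b j := fun i j hij h => (hg i j hij).1 (sub_eq_zero.2 h)
  have hb0 : b ⟨0, by omega⟩ = 0 := by simp [hb, prependZero]
  have hnn : ∀ i, 0 ≤ b i := prependZero_nonneg ha
  have hpos : ∀ i : Fin n, (i : ℕ) ≠ 0 → 0 < b i := fun i hi =>
    lt_of_le_of_ne (hnn i) fun h => hinj i ⟨0, by omega⟩ (fun h' => hi (by simp [h']))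
      (by rw [hb0, ← h])
  have hstep : ∀ (i : ℕ) (h : i + 1 < n), b ⟨i + 1, h⟩ ≤ b ⟨i, by omega⟩ + 1 :=
    fun i h => (ha i h).2
  -- At the largest coordinate every slope is at most 0, and the preceding coordinate lies less than
  -- or exactly 1 below it, contributing −1.
  have hneg : c ≤ -1 := by
    obtain ⟨M, -, hM⟩ := Finset.exists_max_image Finset.univ b ⟨⟨0, by omega⟩, by simp⟩
    have hM0 : (M : ℕ) ≠ 0 := by
      intro h
      have h1 := hM ⟨1, by omega⟩ (by simp)
      have h2 := hpos ⟨1, by omega⟩ (by simp)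
      have h3 : M = ⟨0, by omega⟩ := Fin.ext h
      rw [h3, hb0] at h1
      linarith
    obtain ⟨⟨p, hp⟩, rfl⟩ : ∃ M' : {p : ℕ // p + 1 < n}, M = ⟨M'.1 + 1, M'.2⟩ :=
      ⟨⟨M - 1, by omega⟩, Fin.ext (by simp; omega)⟩
    have hlt : ∀ j, j ≠ ⟨p + 1, hp⟩ → 0 < b ⟨p + 1, hp⟩ - b j := fun j hj =>
      sub_pos.2 (lt_of_le_of_ne (hM j (by simp)) (hinj _ _ hj))
    have hpm : (⟨p, by omega⟩ : Fin n) ≠ ⟨p + 1, hp⟩ := by simp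
    rw [← hc _ hM0, ← Finset.add_sum_erase _ _
      (Finset.mem_erase.2 ⟨hpm, Finset.mem_univ _⟩)]
    have h1 : slope (b ⟨p + 1, hp⟩ - b ⟨p, by omega⟩) = -1 :=
      slope_eq_neg_one (hlt _ hpm) (by linarith [hstep p hp])
    have h2 := Finset.sum_nonpos (s := (Finset.univ.erase (⟨p + 1, hp⟩ : Fin n)).erase ⟨p, by omega⟩)
      (f := fun j => (slope (b ⟨p + 1, hp⟩ - b j) : ℝ)) (fun j hj => slope_of_pos (hlt j
        (Finset.mem_erase.1 (Finset.mem_of_mem_erase hj)).1))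
    rw [h1]
    simp only [SignType.coe_neg_one]
    linarith
  -- At the smallest coordinate other than a_0, only a_0 lies below and contributes at least −1.
  -- Some other coordinate less than 1 above contributes +1, and the rest are nonnegative.
  have hnonneg : 0 ≤ c := by
    obtain ⟨m, hm', hm⟩ := Finset.exists_min_image (Finset.univ.erase (⟨0, by omega⟩ : Fin n)) b
      ⟨⟨1, by omega⟩, by simp⟩
    have hm0 : m ≠ ⟨0, by omega⟩ := (Finset.mem_erase.1 hm').1
    have hm0' : (m : ℕ) ≠ 0 := fun h => hm0 (Fin.ext h)
    have hlt : ∀ j, j ≠ ⟨0, by omega⟩ → j ≠ m → b m - b j < 0 := fun j hj hjm =>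
      sub_neg.2 (lt_of_le_of_ne (hm j (by simp [hj])) (hinj _ _ hjm.symm))
    obtain ⟨j, hj0', hjm, hj⟩ : ∃ j : Fin n, (j : ℕ) ≠ 0 ∧ j ≠ m ∧ b j < b m + 1 := by
      -- The successor of m serves if it exists, genericity making the step inequality strict.
      -- Otherwise m = n−1 ≥ 2 and index 1 serves, because a_1 ≤ 1 < a_m + 1. This is where n ≥ 3
      -- enters.
      by_cases hlast : (m : ℕ) + 1 < n
      · have hne : (⟨m + 1, hlast⟩ : Fin n) ≠ m := by simp [Fin.ext_iff]
        refine ⟨⟨m + 1, hlast⟩, by simp, hne, lt_of_le_of_ne (hstep m hlast) fun h => ?_⟩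
        exact (hg _ _ hne).2.1 (by rw [← hb, h]; simp)
      · refine ⟨⟨1, by omega⟩, by simp, fun h => ?_, ?_⟩
        · have := congrArg Fin.val h
          simp at this
          omega
        · have h1 := hstep 0 (by omega)
          have h2 := hpos m hm0'
          rw [hb0] at h1
          simp only [zero_add] at h1
          linarith
    have hj0 : j ≠ ⟨0, by omega⟩ := fun h => hj0' (by simp [h])
    rw [← hc m hm0', ← Finset.add_sum_erase _ _
      (Finset.mem_erase.2 ⟨hm0.symm, Finset.mem_univ _⟩), ← Finset.add_sum_erase _ _
      (Finset.mem_erase.2 ⟨hj0, Finset.mem_erase.2 ⟨hjm, Finset.mem_univ j⟩⟩)]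
    have h1 := neg_one_le_slope (b m - b ⟨0, by omega⟩)
    have h2 : slope (b m - b j) = 1 := slope_eq_one (by linarith) (hlt j hj0 hjm)
    have h3 := Finset.sum_nonneg
      (s := ((Finset.univ.erase m).erase (⟨0, by omega⟩ : Fin n)).erase j)
      (f := fun i => (slope (b m - b i) : ℝ)) (fun i hi => by
        simp only [Finset.mem_erase] at hi
        exact slope_of_neg (hlt i hi.2.1 hi.2.2.1))
    rw [h2]
    simp only [SignType.coe_one]
    linarith
  linarith

/-- A proper image would be killed by a nonzero functional on the plane. Testing it on the basis
vectors makes all partial derivatives of dinv equal, unless the functional ignores dinv, in which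
case it vanishes on area too. -/
lemma surjective_dinvForm_prod {n : ℕ} (hn : 3 ≤ n) {a : Fin (n - 1) → ℝ}
    (ha : a ∈ areaPolytope n) (hg : IsGeneric (n := n) a) {σ : Fin n → Fin n → SignType}
    (hσ : ∀ i j, slope (prependZero a i - prependZero a j) = σ i j) :
    Function.Surjective ((dinvForm σ).prod (∑ i : Fin n, coordForm i)) := by
  rw [← LinearMap.range_eq_top]
  by_contra hne
  obtain ⟨f, hf, hle⟩ := Submodule.exists_le_ker_of_lt_top _ (lt_top_iff_ne_top.2 hne)
  have hfe : ∀ p : ℝ × ℝ, f p = f (1, 0) * p.1 + f (0, 1) * p.2 := fun p => by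
    have h2 : p = p.1 • (1, 0) + p.2 • (0, 1) := by ext <;> simp
    conv_lhs => rw [h2]
    simp only [map_add, map_smul, smul_eq_mul]
    ring
  have hanti : ∀ i j, i ≠ j → (σ i j : ℝ) = -(σ j i : ℝ) := fun i j hij => by
    obtain ⟨h0, h1, h2⟩ := hg j i hij.symm
    rw [← hσ, ← hσ, ← neg_sub, slope_neg h0 h1 h2]
    simp
  have key : ∀ k : Fin n, (k : ℕ) ≠ 0 →
      f (1, 0) * (∑ j ∈ Finset.univ.erase k, (σ k j : ℝ)) + f (0, 1) = 0 := by
    intro k hk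
    set v : Fin (n - 1) → ℝ := Pi.single ⟨(k : ℕ) - 1, by omega⟩ 1 with hv
    have h1 := hle (LinearMap.mem_range_self _ v)
    rw [LinearMap.mem_ker, hfe] at h1
    have h2 : dinvForm σ v = ∑ j ∈ Finset.univ.erase k, (σ k j : ℝ) := by
      simp only [dinvForm, LinearMap.sum_apply, LinearMap.smul_apply, LinearMap.sub_apply,
        coordForm_apply, smul_eq_mul]
      rw [sum_Ioi_antisymm _ hanti]
      simp only [hv, prependZero_single k hk]
      simp
    have h3 : (∑ i : Fin n, coordForm i) v = 1 := by
      simp only [LinearMap.sum_apply, coordForm_apply, hv, prependZero_single k hk]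
      simp
    change f (1, 0) * dinvForm σ v + f (0, 1) * (∑ i : Fin n, coordForm i) v = 0 at h1
    rwa [h2, h3, mul_one] at h1
  by_cases h10 : f (1, 0) = 0
  · apply hf
    have h01 : f (0, 1) = 0 := by
      have := key ⟨1, by omega⟩ (by simp)
      simpa [h10] using this
    ext <;> simp [h10, h01]
  · obtain ⟨k, hk, hne⟩ := gradient_not_const hn ha hg (-f (0, 1) / f (1, 0))
    apply hne
    simp only [hσ]
    have := key k hk
    field_simp
    linarith

/-- The region of the area polytope where `dinv` has slopes `σ`. -/
def linearityRegion {n : ℕ} (σ : Fin n → Fin n → SignType) : Set (Fin (n - 1) → ℝ) :=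
  areaPolytope n ∩ ⋂ i, ⋂ j, {a | slope (prependZero a i - prependZero a j) = σ i j}

lemma isPWSet_linearityRegion {n : ℕ} (σ : Fin n → Fin n → SignType) :
    IsPWSet (linearityRegion σ) := by
  refine (isPWSet_areaPolytope n).inter (IsPWSet.iInter fun i => IsPWSet.iInter fun j => ?_)
  have := isPWSet_slope (coordForm i - coordForm j).toAffineMap (σ i j)
  simpa using this

/-- A region of positive measure contains a generic point, which is all that surjectivity needs;
null regions get density 0. -/
lemma exists_density_linearityRegion {n : ℕ} (hn : 3 ≤ n) (σ : Fin n → Fin n → SignType) :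
    ∃ g : ℝ × ℝ → ℝ, IsPW (n - 3) g ∧ (∀ p, 0 ≤ g p) ∧
      (volume.restrict (linearityRegion σ)).map (fun a => (dinvFun a, ∑ i, prependZero a i)) =
        volume.withDensity fun p => ENNReal.ofReal (g p) := by
  by_cases hnull : volume (linearityRegion σ) = 0
  · refine ⟨fun _ => 0, IsPW.zero _, fun _ => le_rfl, ?_⟩
    rw [Measure.restrict_eq_zero.2 hnull]
    simp
  · obtain ⟨a, haσ, hg⟩ : ∃ a ∈ linearityRegion σ, IsGeneric a := by
      by_contra! h
      refine hnull (measure_mono_null (fun a ha => ?_) (ae_iff.1 (ae_isGeneric n)))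
      exact h a ha
    have hsl : ∀ {a}, a ∈ linearityRegion σ → ∀ i j,
        slope (prependZero a i - prependZero a j) = σ i j := fun ha i j =>
      Set.mem_iInter.1 (Set.mem_iInter.1 ha.2 i) j
    have hsurj := surjective_dinvForm_prod hn haσ.1 hg (hsl haσ)
    obtain ⟨g, hgPW, hg0, hgm⟩ := exists_density_of_surjective _ hsurj
      (∑ i, ∑ j ∈ Finset.Ioi i, (σ i j : ℝ) ^ 2, 0) (isPWSet_linearityRegion σ)
      ((isBounded_areaPolytope n).subset Set.inter_subset_left)
    refine ⟨g, by simpa [Nat.sub_sub] using hgPW, hg0, ?_⟩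
    rw [← hgm]
    refine Measure.map_congr ?_
    filter_upwards [ae_restrict_mem (isPWSet_linearityRegion σ).measurableSet] with x hx
    ext
    · change dinvFun x = dinvForm σ x + ∑ i, ∑ j ∈ Finset.Ioi i, (σ i j : ℝ) ^ 2
      simp only [dinvFun, sc_eq_slope, hsl hx, Finset.sum_add_distrib, dinvForm,
        LinearMap.sum_apply, LinearMap.smul_apply, LinearMap.sub_apply, coordForm_apply,
        smul_eq_mul]
      ring
    · change _ = (∑ i : Fin n, coordForm i) x + 0
      simp

/-- The `q,t`-Catalan measure has a piecewise polynomial density. -/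
lemma exists_density {n : ℕ} (hn : 3 ≤ n) :
    ∃ g : ℝ × ℝ → ℝ, IsPW (n - 3) g ∧ (∀ p, 0 ≤ g p) ∧
      qtCatalanMeasure n = volume.withDensity fun p => ENNReal.ofReal (g p) := by
  classical
  choose g hg hg0 hgm using fun σ => exists_density_linearityRegion hn σ
  refine ⟨fun p => ∑ σ, g σ p, IsPW.sum _ fun σ _ => hg σ,
    fun p => Finset.sum_nonneg fun σ _ => hg0 σ p, ?_⟩
  have hF : Measurable fun a : Fin (n - 1) → ℝ => (dinvFun a, ∑ i, prependZero a i) :=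
    (measurable_dinvFun n).prodMk (Finset.measurable_sum _ fun i _ => measurable_prependZero i)
  have hU : areaPolytope n = ⋃ σ, linearityRegion σ := by
    ext a
    simp only [linearityRegion, Set.mem_iUnion, Set.mem_inter_iff, Set.mem_iInter,
      Set.mem_ofPred_eq]
    exact ⟨fun h => ⟨fun i j => slope (prependZero a i - prependZero a j), h, fun _ _ => rfl⟩,
      fun ⟨_, h, _⟩ => h⟩
  have hd : Pairwise (Function.onFun Disjoint (linearityRegion (n := n))) := by
    intro σ τ hστ
    rw [Function.onFun, Set.disjoint_left]
    intro a h1 h2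
    apply hστ
    ext1 i; ext1 j
    rw [← Set.mem_iInter.1 (Set.mem_iInter.1 h1.2 i) j,
      ← Set.mem_iInter.1 (Set.mem_iInter.1 h2.2 i) j]
  ext s hs
  rw [qtCatalanMeasure_eq, hU, Measure.restrict_iUnion hd
    fun σ => (isPWSet_linearityRegion σ).measurableSet, Measure.map_apply hF hs,
    Measure.sum_apply _ (hF hs), tsum_fintype, withDensity_apply _ hs]
  simp only [ENNReal.ofReal_sum_of_nonneg fun σ _ => hg0 σ _]
  rw [lintegral_finsetSum _ fun σ _ => (hg σ).measurable.ennreal_ofReal]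
  refine Finset.sum_congr rfl fun σ _ => ?_
  rw [← Measure.map_apply hF hs, hgm σ, withDensity_apply _ hs]

/-! ### The density near the vertex of maximal area -/

/-- Near the path of maximal area, `dinv` is the last coordinate of the path. -/
lemma dinv_eq_last {k : ℕ} {x : Fin (k + 1) → ℝ} (hx : Monotone x) (h0 : x 0 = 0)
    (h1 : x (Fin.last k) < 1) :
    ∑ i : Fin (k + 1), ∑ j ∈ Finset.Ioi i, sc (((i : ℕ) - x i) - ((j : ℕ) - x j)) =
      x (Fin.last k) := by
  have hx0 : ∀ i, 0 ≤ x i := fun i => h0 ▸ hx (Fin.zero_le i)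
  have hx1 : ∀ i, x i < 1 := fun i => (hx (Fin.le_last i)).trans_lt h1
  -- Only consecutive pairs contribute: for j ≥ i + 2 the area coordinates differ by more than 1.
  -- The contributions x_(i+1) − x_i telescope.
  have key : ∀ i : Fin k, ∑ j ∈ Finset.Ioi i.castSucc,
      sc (((i.castSucc : ℕ) - x i.castSucc) - ((j : ℕ) - x j)) = x i.succ - x i.castSucc := by
    intro i
    have hmono : x i.castSucc ≤ x i.succ := hx (Fin.castSucc_lt_succ).le
    rw [Finset.sum_eq_single i.succ]
    · have e : ((i.castSucc : ℕ) - x i.castSucc) - ((i.succ : ℕ) - x i.succ) =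
          -(1 - (x i.succ - x i.castSucc)) := by
        simp only [Fin.val_castSucc, Fin.val_succ]; push_cast; ring
      rw [e, sc, abs_neg, abs_of_nonneg (by linarith [hx1 i.succ, hx0 i.castSucc]),
        max_eq_left (by linarith)]
      ring
    · intro j hj hne
      have hij : (i : ℕ) + 2 ≤ j := by
        have h2 : i.castSucc < j := Finset.mem_Ioi.1 hj
        rw [Fin.lt_def, Fin.val_castSucc] at h2
        have h3 : (j : ℕ) ≠ i + 1 := fun h => hne (Fin.ext h)
        omega
      have hij' : (i : ℝ) + 2 ≤ (j : ℕ) := by exact_mod_cast hij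
      rw [sc, max_eq_right]
      have := neg_le_abs (((i.castSucc : ℕ) - x i.castSucc) - ((j : ℕ) - x j))
      simp only [Fin.val_castSucc] at this ⊢
      linarith [hx1 j, hx0 i.castSucc]
    · intro h
      exact absurd (Finset.mem_Ioi.2 (Fin.castSucc_lt_succ)) h
  have hlast : Finset.Ioi (Fin.last k) = ∅ := by
    ext j; simp [Fin.le_last]
  rw [Fin.sum_univ_castSucc, hlast, Finset.sum_empty, add_zero, Finset.sum_congr rfl
    fun i _ => key i, Finset.sum_sub_distrib]
  have e1 := Fin.sum_univ_succ x
  have e2 := Fin.sum_univ_castSucc x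
  linarith

/-- The cone of weakly increasing nonnegative vectors. -/
def monotoneCone (m : ℕ) : Set (Fin (m + 1) → ℝ) := {y | 0 ≤ y 0 ∧ Monotone y}

lemma nonneg_of_mem_monotoneCone {m : ℕ} {y : Fin (m + 1) → ℝ} (hy : y ∈ monotoneCone m)
    (i : Fin (m + 1)) : 0 ≤ y i :=
  hy.1.trans (hy.2 (Fin.zero_le i))

lemma le_sum_of_mem_monotoneCone {m : ℕ} {y : Fin (m + 1) → ℝ} (hy : y ∈ monotoneCone m)
    (i : Fin (m + 1)) : y i ≤ ∑ j, y j :=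
  Finset.single_le_sum (fun j _ => nonneg_of_mem_monotoneCone hy j) (Finset.mem_univ i)

lemma smul_mem_monotoneCone {m : ℕ} {y : Fin (m + 1) → ℝ} (hy : y ∈ monotoneCone m) {r : ℝ}
    (hr : 0 ≤ r) : r • y ∈ monotoneCone m :=
  ⟨mul_nonneg hr hy.1, fun _ _ hij => mul_le_mul_of_nonneg_left (hy.2 hij) hr⟩

/-- The part of the cone of coordinate sum at most `w`. -/
def truncatedCone (m : ℕ) (w : ℝ) : Set (Fin (m + 1) → ℝ) :=
  monotoneCone m ∩ {y | ∑ i, y i ≤ w}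

open scoped Pointwise in
lemma volume_truncatedCone_smul (m : ℕ) {w : ℝ} (hw : 0 < w) :
    volume (truncatedCone m w) = ENNReal.ofReal (w ^ (m + 1)) * volume (truncatedCone m 1) := by
  have e : truncatedCone m w = w • truncatedCone m 1 := by
    ext y
    rw [Set.mem_smul_set_iff_inv_smul_mem₀ hw.ne']
    simp only [truncatedCone, Set.mem_inter_iff, Set.mem_ofPred_eq, Pi.smul_apply, smul_eq_mul,
      ← Finset.mul_sum]
    rw [inv_mul_le_iff₀ hw, mul_one]
    refine and_congr_left fun _ => ⟨fun h => smul_mem_monotoneCone h (by positivity), fun h => ?_⟩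
    have := smul_mem_monotoneCone h hw.le
    rwa [smul_inv_smul₀ hw.ne'] at this
  rw [e, Measure.addHaar_smul]
  simp [abs_of_pos hw]

lemma volume_truncatedCone_ne_top (m : ℕ) : volume (truncatedCone m 1) ≠ ⊤ := by
  refine (Bornology.IsBounded.measure_lt_top ?_).ne
  refine isBounded_iff_forall_norm_le.2 ⟨1, fun y hy => ?_⟩
  refine (pi_norm_le_iff_of_nonneg zero_le_one).2 fun i => ?_
  rw [Real.norm_of_nonneg (nonneg_of_mem_monotoneCone hy.1 i)]
  exact (le_sum_of_mem_monotoneCone hy.1 i).trans hy.2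

lemma volume_truncatedCone_ne_zero (m : ℕ) : volume (truncatedCone m 1) ≠ 0 := by
  set U : Set (Fin (m + 1) → ℝ) := {y | 0 < y 0} ∩ {y | ∑ i, y i < 1} ∩
    ⋂ i, ⋂ j, ⋂ _ : i < j, {y | y i < y j} with hU
  have hopen : IsOpen U := by
    refine ((isOpen_lt continuous_const (continuous_apply 0)).inter
      (isOpen_lt (by fun_prop) continuous_const)).inter ?_
    exact isOpen_iInter_of_finite fun i => isOpen_iInter_of_finite fun j =>
      isOpen_iInter_of_finite fun _ => isOpen_lt (continuous_apply i) (continuous_apply j)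
  have hne : U.Nonempty := by
    set D : ℝ := ∑ i : Fin (m + 1), ((i : ℕ) + 1 : ℝ) with hD
    have hDpos : 0 < D := Finset.sum_pos (fun i _ => by positivity) ⟨0, by simp⟩
    -- The vector (1, …, m+1), scaled to have sum 1/2.
    refine ⟨fun i => ((i : ℕ) + 1 : ℝ) / (2 * D), ⟨?_, ?_⟩, ?_⟩
    · simp only [Set.mem_ofPred_eq]; positivity
    · simp only [Set.mem_ofPred_eq]
      rw [← Finset.sum_div, ← hD, div_lt_one (by positivity)]
      linarith
    · simp only [Set.mem_iInter, Set.mem_ofPred_eq]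
      intro i j hij
      have : ((i : ℕ) : ℝ) < (j : ℕ) := by exact_mod_cast hij
      gcongr
  have hsub : U ⊆ truncatedCone m 1 := by
    rintro y ⟨⟨h0, h1⟩, h2⟩
    simp only [Set.mem_iInter, Set.mem_ofPred_eq] at h0 h1 h2
    refine ⟨⟨h0.le, fun i j hij => ?_⟩, h1.le⟩
    rcases hij.eq_or_lt with rfl | h
    exacts [le_rfl, (h2 i j h).le]
  exact ((hopen.measure_pos volume hne).trans_le (measure_mono hsub)).ne'

/-- The distribution of the coordinate sum on the cone. -/
noncomputable def coneSumMeasure (m : ℕ) : Measure ℝ :=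
  (volume.restrict (monotoneCone m)).map fun y => ∑ i, y i

lemma measurable_coordSum (m : ℕ) : Measurable fun y : Fin (m + 1) → ℝ => ∑ i, y i := by
  fun_prop

lemma coneSumMeasure_Iic (m : ℕ) (w : ℝ) : coneSumMeasure m (Set.Iic w) =
    ENNReal.ofReal ((max w 0) ^ (m + 1)) * volume (truncatedCone m 1) := by
  have h : ∀ w, coneSumMeasure m (Set.Iic w) = volume (truncatedCone m w) := fun w => by
    rw [coneSumMeasure, Measure.map_apply (measurable_coordSum m) measurableSet_Iic,
      Measure.restrict_apply (measurable_coordSum m measurableSet_Iic), Set.inter_comm]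
    rfl
  rw [h]
  rcases lt_or_ge 0 w with hw | hw
  · rw [max_eq_left hw.le, volume_truncatedCone_smul m hw]
  · have hsub : truncatedCone m w ⊆ {0} := by
      rintro y ⟨hy, hs⟩
      ext i
      exact le_antisymm ((le_sum_of_mem_monotoneCone hy i).trans (hs.trans hw))
        (nonneg_of_mem_monotoneCone hy i)
    rw [max_eq_right hw, measure_mono_null hsub (by simp)]
    simp

/-- By homogeneity the distribution function is C·w^(m+1) for w ≥ 0, with derivative (m+1)C·w^m.
Restricting to w ≤ 1 makes the measure finite, hence determined by its distribution function. -/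
lemma coneSumMeasure_restrict (m : ℕ) : ∃ c : ℝ, 0 < c ∧
    (coneSumMeasure m).restrict (Set.Iic 1) =
      (volume.restrict (Set.Ioc 0 1)).withDensity fun w => ENNReal.ofReal (c * w ^ m) := by
  set C := (volume (truncatedCone m 1)).toReal with hC
  have hCpos : 0 < C := ENNReal.toReal_pos (volume_truncatedCone_ne_zero m)
    (volume_truncatedCone_ne_top m)
  have hCeq : volume (truncatedCone m 1) = ENNReal.ofReal C :=
    (ENNReal.ofReal_toReal (volume_truncatedCone_ne_top m)).symm
  have hρ : ∀ w, coneSumMeasure m (Set.Iic w) = ENNReal.ofReal ((max w 0) ^ (m + 1) * C) :=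
    fun w => by
      rw [coneSumMeasure_Iic, hCeq, ENNReal.ofReal_mul (by positivity)]
  have : IsFiniteMeasure ((coneSumMeasure m).restrict (Set.Iic 1)) :=
    ⟨by rw [Measure.restrict_apply_univ, hρ]; exact ENNReal.ofReal_lt_top⟩
  refine ⟨(m + 1) * C, by positivity, Measure.ext_of_Iic _ _ fun w => ?_⟩
  rw [Measure.restrict_apply measurableSet_Iic, Set.Iic_inter_Iic, hρ,
    withDensity_apply _ measurableSet_Iic, Measure.restrict_restrict measurableSet_Iic]
  have hset : Set.Iic w ∩ Set.Ioc 0 1 = Set.Ioc 0 (max (min w 1) 0) := by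
    ext t
    simp only [Set.mem_inter_iff, Set.mem_Iic, Set.mem_Ioc]
    constructor
    · rintro ⟨h1, h2, h3⟩
      exact ⟨h2, le_max_of_le_left (le_min h1 h3)⟩
    · rintro ⟨h1, h2⟩
      rcases le_max_iff.1 h2 with h | h
      · exact ⟨h.trans (min_le_left _ _), h1, h.trans (min_le_right _ _)⟩
      · linarith
  set v := max (min w 1) 0 with hv
  have hv0 : 0 ≤ v := le_max_right _ _
  have hcont : Continuous fun t : ℝ => (m + 1) * C * t ^ m := by fun_prop
  have hnn : 0 ≤ᵐ[volume.restrict (Set.Ioc 0 v)] fun t : ℝ => (m + 1) * C * t ^ m := by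
    filter_upwards [ae_restrict_mem measurableSet_Ioc] with t ht
    have := ht.1.le
    simp only [Pi.zero_apply]
    positivity
  rw [hset, ← ofReal_integral_eq_lintegral_ofReal
    ((hcont.integrableOn_Icc (a := 0) (b := v)).mono_set Set.Ioc_subset_Icc_self) hnn,
    ← intervalIntegral.integral_of_le hv0, intervalIntegral.integral_const_mul, integral_pow]
  congr 1
  have : (m : ℝ) + 1 ≠ 0 := by positivity
  field_simp
  simp

/-- Coordinates near the vertex of maximal area: `s` is the last and `y` the vector of the other
`x`-coordinates of the path. -/
def vertexCoord (m : ℕ) (z : ℝ × (Fin (m + 1) → ℝ)) : Fin (m + 3 - 1) → ℝ :=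
  fun k : Fin (m + 2) => ((k : ℕ) + 1 : ℝ) - (Fin.snoc z.2 z.1 : Fin (m + 2) → ℝ) k

lemma measurePreserving_vertexCoord (m : ℕ) : MeasurePreserving (vertexCoord m) := by
  have h1 := (volume_preserving_piFinSuccAbove (fun _ : Fin (m + 2) => ℝ) (Fin.last _)).symm
  have h2 := (Measure.measurePreserving_sub_left (volume : Measure (Fin (m + 2) → ℝ))
    (fun k => ((k : ℕ) + 1 : ℝ))).comp h1
  have h3 : (fun z => (vertexCoord m z : Fin (m + 2) → ℝ)) =
      (fun x => (fun k : Fin (m + 2) => ((k : ℕ) + 1 : ℝ)) - x) ∘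
        (MeasurableEquiv.piFinSuccAbove (fun _ : Fin (m + 2) => ℝ) (Fin.last _)).symm := by
    ext z k
    simp [vertexCoord, MeasurableEquiv.piFinSuccAbove, Fin.insertNthEquiv]
  rw [← h3] at h2
  exact h2

lemma prependZero_vertexCoord (m : ℕ) (z : ℝ × (Fin (m + 1) → ℝ)) (i : Fin (m + 3)) :
    prependZero (n := m + 3) (vertexCoord m z) i =
      (i : ℕ) - (Fin.cons 0 (Fin.snoc z.2 z.1 : Fin (m + 2) → ℝ) : Fin (m + 3) → ℝ) i := by
  refine Fin.cases ?_ (fun k => ?_) i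
  · simp [prependZero]
  · simp [prependZero, vertexCoord]

/-- The area of the path of maximal area. -/
def maxArea (m : ℕ) : ℝ := ∑ i : Fin (m + 3), ((i : ℕ) : ℝ)

lemma sum_prependZero_vertexCoord (m : ℕ) (z : ℝ × (Fin (m + 1) → ℝ)) :
    ∑ i, prependZero (n := m + 3) (vertexCoord m z) i = maxArea m - z.1 - ∑ i, z.2 i := by
  simp only [prependZero_vertexCoord, Finset.sum_sub_distrib, maxArea]
  rw [Fin.sum_univ_succ (Fin.cons 0 (Fin.snoc z.2 z.1 : Fin (m + 2) → ℝ) : Fin (m + 3) → ℝ)]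
  simp only [Fin.cons_zero, Fin.cons_succ]
  rw [Fin.sum_univ_castSucc (Fin.snoc z.2 z.1 : Fin (m + 2) → ℝ)]
  simp only [Fin.snoc_castSucc, Fin.snoc_last]
  ring

lemma monotone_of_vertexCoord_mem {m : ℕ} {z : ℝ × (Fin (m + 1) → ℝ)}
    (h : vertexCoord m z ∈ areaPolytope (m + 3)) :
    Monotone (Fin.cons 0 (Fin.snoc z.2 z.1 : Fin (m + 2) → ℝ) : Fin (m + 3) → ℝ) := by
  intro i j hij
  have := ((areaEquiv (m + 3)).symm ⟨_, h⟩).mono i j hij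
  simp only [areaEquiv, Equiv.coe_fn_symm_mk, prependZero_vertexCoord] at this
  linarith

lemma vertexCoord_mem {m : ℕ} {z : ℝ × (Fin (m + 1) → ℝ)} (hz : z.2 ∈ monotoneCone m)
    (hlast : z.2 (Fin.last m) ≤ z.1) (h1 : z.1 ≤ 1) :
    vertexCoord m z ∈ areaPolytope (m + 3) := by
  set x : Fin (m + 3) → ℝ := Fin.cons 0 (Fin.snoc z.2 z.1 : Fin (m + 2) → ℝ) with hx
  have hmono : Monotone x := by
    refine Fin.monotone_iff_le_succ.2 fun i => ?_
    refine Fin.cases ?_ (fun j => ?_) i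
    · have e : (0 : Fin (m + 2)) = Fin.castSucc 0 := rfl
      simp only [hx, Fin.cons_succ, Fin.castSucc_zero, Fin.cons_zero]
      rw [e, Fin.snoc_castSucc (α := fun _ => ℝ)]
      exact hz.1
    · rw [← Fin.succ_castSucc]
      simp only [hx, Fin.cons_succ]
      rw [Fin.snoc_castSucc (α := fun _ => ℝ)]
      refine Fin.lastCases ?_ (fun l => ?_) j
      · simpa using hlast
      · rw [Fin.succ_castSucc, Fin.snoc_castSucc (α := fun _ => ℝ)]
        exact hz.2 (Fin.castSucc_lt_succ).le
  have hxlast : x (Fin.last _) = z.1 := by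
    rw [← Fin.succ_last]
    simp [hx]
  intro i hi
  simp only [prependZero_vertexCoord, ← hx]
  have h2 := hmono (Fin.le_last ⟨i + 1, hi⟩)
  have h3 : x ⟨i, by omega⟩ ≤ x ⟨i + 1, hi⟩ := hmono (by simp)
  rw [hxlast] at h2
  have h4 : (0 : ℝ) ≤ i := Nat.cast_nonneg i
  push_cast
  constructor <;> linarith

lemma dinvFun_vertexCoord {m : ℕ} {z : ℝ × (Fin (m + 1) → ℝ)}
    (h : vertexCoord m z ∈ areaPolytope (m + 3)) (h1 : z.1 < 1) :
    dinvFun (n := m + 3) (vertexCoord m z) = z.1 := by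
  have hlast : (Fin.cons 0 (Fin.snoc z.2 z.1 : Fin (m + 2) → ℝ) : Fin (m + 3) → ℝ)
      (Fin.last _) = z.1 := by
    rw [← Fin.succ_last]
    simp
  simp only [dinvFun, prependZero_vertexCoord]
  rw [dinv_eq_last (monotone_of_vertexCoord_mem h) (by simp) (by rwa [hlast]), hlast]

lemma mem_monotoneCone_of_vertexCoord_mem {m : ℕ} {z : ℝ × (Fin (m + 1) → ℝ)}
    (h : vertexCoord m z ∈ areaPolytope (m + 3)) : z.2 ∈ monotoneCone m := by
  have hm := monotone_of_vertexCoord_mem h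
  have e : ∀ j, z.2 j = (Fin.cons 0 (Fin.snoc z.2 z.1 : Fin (m + 2) → ℝ) : Fin (m + 3) → ℝ)
      j.castSucc.succ := fun j => by simp
  refine ⟨?_, fun i j hij => ?_⟩
  · rw [e]
    exact hm (Fin.zero_le (Fin.castSucc (0 : Fin (m + 1))).succ)
  · rw [e, e]
    exact hm (by simpa using hij)

/-- An open set of values of `(dinv, area)` close to the vertex of maximal area. -/
def vertexRegion (m : ℕ) : Set (ℝ × ℝ) :=
  {p | 1 / 4 < p.1 ∧ p.1 < 1 / 2 ∧ 0 < maxArea m - p.2 - p.1 ∧ maxArea m - p.2 - p.1 < 1 / 4}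

lemma isOpen_vertexRegion (m : ℕ) : IsOpen (vertexRegion m) :=
  have h : Continuous fun p : ℝ × ℝ => maxArea m - p.2 - p.1 := by fun_prop
  (isOpen_lt continuous_const continuous_fst).inter
    ((isOpen_lt continuous_fst continuous_const).inter
      ((isOpen_lt continuous_const h).inter (isOpen_lt h continuous_const)))

lemma nonempty_vertexRegion (m : ℕ) : (vertexRegion m).Nonempty :=
  ⟨(3 / 8, maxArea m - 1 / 2), by norm_num [vertexRegion]⟩

/-- The numerical bounds decouple s from y: each y_i is at most the sum w < 1/4 < s, so y ≤ s is
automatic and only the cone condition on y remains. -/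
lemma vertexCoord_preimage {m : ℕ} {s : Set (ℝ × ℝ)} (hs : s ⊆ vertexRegion m)
    (z : ℝ × (Fin (m + 1) → ℝ)) :
    (vertexCoord m z ∈ areaPolytope (m + 3) ∧
      (dinvFun (n := m + 3) (vertexCoord m z),
        ∑ i, prependZero (n := m + 3) (vertexCoord m z) i) ∈ s) ↔
    z.2 ∈ monotoneCone m ∧ (z.1, maxArea m - z.1 - ∑ i, z.2 i) ∈ s := by
  rw [sum_prependZero_vertexCoord]
  constructor
  · rintro ⟨h1, h2⟩
    have hc := mem_monotoneCone_of_vertexCoord_mem h1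
    obtain ⟨-, h4, -, h6⟩ := hs h2
    simp only at h4 h6
    have h0 : 0 ≤ ∑ i, z.2 i := Finset.sum_nonneg fun i _ => nonneg_of_mem_monotoneCone hc i
    -- Before dinv is known to be s, the bounds already give s + Σ y < dinv + 1/4 < 3/4.
    rw [dinvFun_vertexCoord h1 (by linarith)] at h2
    exact ⟨hc, h2⟩
  · rintro ⟨hc, h2⟩
    obtain ⟨h3, h4, h5, h6⟩ := hs h2
    simp only at h3 h4 h5 h6
    have hl := le_sum_of_mem_monotoneCone hc (Fin.last m)
    have h1 := vertexCoord_mem hc (by linarith) (by linarith)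
    rw [dinvFun_vertexCoord h1 (by linarith)]
    exact ⟨h1, h2⟩

/-- Fubini in the coordinates (s, y): for fixed s = dinv, the area depends on y only through its
sum. -/
lemma qtCatalanMeasure_apply_of_subset {m : ℕ} {s : Set (ℝ × ℝ)} (hsm : MeasurableSet s)
    (hs : s ⊆ vertexRegion m) : qtCatalanMeasure (m + 3) s =
      ∫⁻ x, coneSumMeasure m {w | (x, maxArea m - x - w) ∈ s} := by
  have hF : Measurable fun a : Fin (m + 3 - 1) → ℝ =>
      (dinvFun (n := m + 3) a, ∑ i, prependZero (n := m + 3) a i) :=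
    (measurable_dinvFun (m + 3)).prodMk
      (Finset.measurable_sum _ fun i _ => measurable_prependZero i)
  have hA := (isPWSet_areaPolytope (m + 3)).measurableSet
  rw [qtCatalanMeasure_eq, Measure.map_apply hF hsm, Measure.restrict_apply (hF hsm),
    ← (measurePreserving_vertexCoord m).measure_preimage ((hF hsm).inter hA).nullMeasurableSet,
    Measure.volume_eq_prod,
    Measure.prod_apply ((measurePreserving_vertexCoord m).measurable ((hF hsm).inter hA))]
  refine lintegral_congr fun x => ?_
  have hmeas : MeasurableSet {w : ℝ | (x, maxArea m - x - w) ∈ s} :=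
    (by fun_prop : Measurable fun w : ℝ => (x, maxArea m - x - w)) hsm
  rw [coneSumMeasure, Measure.map_apply (measurable_coordSum m) hmeas,
    Measure.restrict_apply (measurable_coordSum m hmeas)]
  congr 1
  ext y
  have := vertexCoord_preimage hs (x, y)
  simp only [Set.mem_preimage, Set.mem_inter_iff, Set.mem_ofPred_eq]
  rw [and_comm, this, and_comm]

/-- Near the vertex of maximal area the density of the `q,t`-Catalan measure is a multiple of a
power of an affine form. -/
lemma exists_density_near_vertex (m : ℕ) {f : ℝ × ℝ → ℝ} (hf : Measurable f)
    (hf0 : ∀ p, 0 ≤ f p) (hfm : qtCatalanMeasure (m + 3) =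
      volume.withDensity fun p => ENNReal.ofReal (f p)) :
    ∃ c : ℝ, c ≠ 0 ∧ f =ᵐ[volume.restrict (vertexRegion m)]
      fun p => c * (maxArea m - p.2 - p.1) ^ m := by
  obtain ⟨c, hc, hρ⟩ := coneSumMeasure_restrict m
  refine ⟨c, hc.ne', ?_⟩
  have hB := (isOpen_vertexRegion m).measurableSet
  have hh : Measurable fun p : ℝ × ℝ => ENNReal.ofReal (c * (maxArea m - p.2 - p.1) ^ m) := by
    fun_prop
  have key : (volume.restrict (vertexRegion m)).withDensity (fun p => ENNReal.ofReal (f p)) =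
      (volume.restrict (vertexRegion m)).withDensity
        fun p => ENNReal.ofReal (c * (maxArea m - p.2 - p.1) ^ m) := by
    rw [← restrict_withDensity hB, ← hfm]
    ext s hs
    have hsB := hs.inter hB
    rw [Measure.restrict_apply hs, withDensity_apply _ hs, Measure.restrict_restrict hs,
      qtCatalanMeasure_apply_of_subset hsB Set.inter_subset_right,
      ← lintegral_indicator hsB, Measure.volume_eq_prod,
      lintegral_prod _ (hh.indicator hsB).aemeasurable]
    refine lintegral_congr fun x => ?_
    set F : Set ℝ := {w | (x, maxArea m - x - w) ∈ s ∩ vertexRegion m} with hF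
    have hFm : MeasurableSet F :=
      (by fun_prop : Measurable fun w : ℝ => (x, maxArea m - x - w)) hsB
    have hF1 : F ⊆ Set.Ioc 0 1 := by
      rintro w ⟨-, -, -, h1, h2⟩
      simp only at h1 h2
      constructor <;> linarith
    -- On the slice dinv = x, the substitution w = (maximal area) − x − y turns the density c·w^m in
    -- w into the stated one in the area y.
    rw [← Set.inter_eq_left.2 (hF1.trans Set.Ioc_subset_Iic_self), ← Measure.restrict_apply hFm,
      hρ, withDensity_apply _ hFm, Measure.restrict_restrict hFm, Set.inter_eq_left.2 hF1,
      ← lintegral_indicator hFm, ← lintegral_sub_left_eq_self _ (maxArea m - x)]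
    refine lintegral_congr fun y => ?_
    have e : maxArea m - x - (maxArea m - x - y) = y := by ring
    have e2 : maxArea m - x - y = maxArea m - y - x := by ring
    by_cases hy : (x, y) ∈ s ∩ vertexRegion m
    · rw [Set.indicator_of_mem hy, Set.indicator_of_mem (by simpa [hF, e] using hy), e2]
    · rw [Set.indicator_of_notMem hy, Set.indicator_of_notMem (by simpa [hF, e] using hy)]
  have hae := (withDensity_eq_iff_of_sigmaFinite hf.ennreal_ofReal.aemeasurable
    hh.aemeasurable).1 key
  filter_upwards [hae, ae_restrict_mem hB] with p hp hpB
  have h0 : 0 ≤ c * (maxArea m - p.2 - p.1) ^ m := mul_nonneg hc.le (pow_nonneg hpB.2.2.1.le m)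
  exact (ENNReal.ofReal_eq_ofReal_iff (hf0 p) h0).1 hp

end QTCatalan

theorem mainTheorem7 (n : ℕ) (hn : 3 ≤ n) :
    (QTCatalan.qtCatalanMeasure n).AbsolutelyContinuous
        (MeasureTheory.volume : MeasureTheory.Measure (ℝ × ℝ)) ∧
      ∃ f : ℝ × ℝ → ℝ,
        Measurable f ∧ (∀ p, 0 ≤ f p) ∧
        QTCatalan.qtCatalanMeasure n =
          (MeasureTheory.volume : MeasureTheory.Measure (ℝ × ℝ)).withDensity
            (fun p => ENNReal.ofReal (f p)) ∧
        QTCatalan.IsPiecewisePolynomialOfDegree f (n - 3) := by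
  obtain ⟨f, hf, hf0, hfm⟩ := QTCatalan.exists_density hn
  obtain ⟨m, rfl⟩ : ∃ m, n = m + 3 := ⟨n - 3, by omega⟩
  obtain ⟨c, hc, h⟩ := QTCatalan.exists_density_near_vertex m hf.measurable hf0 hfm
  exact ⟨hfm ▸ MeasureTheory.withDensity_absolutelyContinuous _ _, f, hf.measurable, hf0, hfm,
    hf.isPiecewisePolynomialOfDegree (QTCatalan.isOpen_vertexRegion m)
      (QTCatalan.nonempty_vertexRegion m) hc h⟩
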